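/- Let $\mathbb S^1\subset\mathbb R^2=\mathbb C$ be the unit circle with angle $\theta\in[0,2\pi)$, and let $\mathrm{Diff}^k_+(\mathbb S^1)$ be the group of orientation preserving $C^k$ diffeomorphisms of $\mathbb S^1$, where $\phi'>0$ is defined by $\phi^*d\theta=\phi'\,d\theta$. A point $p$ is a balance point of $\phi$ if $\phi(-p)=-\phi(p)$. Let $\mathrm{BDiff}$ be the set of $\phi\in\mathrm{Diff}^1_+(\mathbb S^1)$ with at least $4$ (possibly infinitely many) balance points, and $\overline{\mathrm{BDiff}}$ its closure in $\mathrm{Diff}^1_+(\mathbb S^1)$ for the $C^1$ topology. Let $\mathrm{M\ddot ob}(\mathbb S^1)$ be the group of maps $x\mapsto Lx/|Lx|$ with $L\in SL(2,\mathbb R)$. For $\tau\in\mathbb R$ let $\psi_\tau:\mathbb S^1\to\mathbb S^1$ be given by $$\theta(\psi_\tau(p))=\cot^{-1}\!\big(\tau+\cot(\theta(p)-\tfrac{\pi}{2})\big)+\tfrac{\pi}{2}\quad\text{if }\tfrac{\pi}{2}<\theta(p)<\tfrac{3\pi}{2},\qquad \psi_\tau(p)=p\quad\text{otherwise},$$ where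 $\cot^{-1}:\mathbb R\to(0,\pi)$. Let $\phi\in\mathrm{Diff}^1_+(\mathbb S^1)$ be such that $u=\log\phi'$ belongs to $H^1(\mathbb S^1)$ and satisfies $\int_{\mathbb S^1}e^{u}\,d\theta=2\pi$, and set $$\mathcal E_G^*[\phi]=\int_{\mathbb S^1}\Big(\tfrac14(u')^2-e^{2u}\Big)\,d\theta+2\pi .$$ If $\phi\in\overline{\mathrm{BDiff}}$, then $\mathcal E_G^*[\phi]\ge 0$, with equality if and only if $\phi=R\circ\psi_\tau\circ\hat\phi$ for some rotation $R$ of $\mathbb S^1$, some $\tau\in\mathbb R$ and some $\hat\phi\in\mathrm{M\ddot ob}(\mathbb S^1)$. If, in addition, $\phi\in\mathrm{Diff}^2_+(\mathbb S^1)$ or $\phi\in\mathrm{BDiff}$, then equality occurs if and only if $\phi\in\mathrm{M\ddot ob}(\mathbb S^1)$. -/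

import Mathlib

open Real MeasureTheory Set
open scoped Manifold ContDiff ComplexConjugate

namespace OvalsBL

noncomputable section

/-! The unit circle is `Circle`, the unit complex numbers; `Circle.exp` is the covering map
`x ↦ e^{ix}`, and the antipodal involution is `p ↦ -p`. -/

/-- The Borel sigma-algebra on the circle. -/
instance instMeasurableSpaceCircle : MeasurableSpace Circle := borel Circle

instance instBorelSpaceCircle : BorelSpace Circle := ⟨rfl⟩

/-- The chart `θ : 𝕊¹ → [0, 2π)` with `θ(1) = 0`. -/
def theta (p : Circle) : ℝ := toIcoMod Real.two_pi_pos 0 (Complex.arg (p : ℂ))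

/-- The arc length measure `dθ` on the circle, of total mass `2π`. -/
def dtheta : Measure Circle := (volume.restrict (Ico (0 : ℝ) (2 * π))).map Circle.exp

/-- The derivative `∂_θ f` of a real function on the circle. -/
def partialTheta (f : Circle → ℝ) (p : Circle) : ℝ :=
  deriv (fun t : ℝ => f (p * Circle.exp t)) 0

/-- The derivative `φ'` of a self-map of the circle, `φ^* dθ = φ' dθ`. At `z ∈ 𝕊¹ ⊆ ℂ` the form
`dθ` sends a tangent vector `v ∈ ℂ` to `Im (conj z * v)`. -/
def angDeriv (φ : Circle → Circle) (p : Circle) : ℝ :=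
  (conj (φ p : ℂ) * deriv (fun t : ℝ => ((φ (p * Circle.exp t) : Circle) : ℂ)) 0).im

/-- `Diff₊^k(𝕊¹)` for `k ≥ 1`: bijections of class `C^k` with inverse of class `C^k` that preserve
the orientation. -/
def DiffPlus (k : ℕ∞) : Set (Equiv.Perm Circle) :=
  {φ | ContMDiff (𝓡 1) (𝓡 1) k φ ∧ ContMDiff (𝓡 1) (𝓡 1) k φ.symm ∧ ∀ p, 0 < angDeriv φ p}

/-- The `C¹` topology on `Diff₊^1(𝕊¹)`: uniform convergence of `φ` and of `φ'`. -/
instance instTopologicalSpaceDiffPlusOne : TopologicalSpace (DiffPlus 1) :=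
  TopologicalSpace.induced
    (fun φ => ((UniformFun.ofFun (φ : Equiv.Perm Circle), UniformFun.ofFun (angDeriv φ.1)) :
      UniformFun Circle Circle × UniformFun Circle ℝ))
    inferInstance

/-- The set of balance points of `φ`. -/
def balancePoints (φ : Equiv.Perm Circle) : Set Circle := {p | φ (-p) = -φ p}

/-- The possibly infinite number `n_B(φ)` of balance points. -/
def nB (φ : Equiv.Perm Circle) : ℕ∞ := (balancePoints φ).encard

/-- The diffeomorphisms of class `C¹` with at least `N` balance points. -/
def BDiff (N : ℕ∞) : Set (DiffPlus 1) := {φ | N ≤ nB φ.1}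

/-- `v` is a weak derivative of `u` on the circle. -/
def IsWeakDeriv (u v : Circle → ℝ) : Prop :=
  ∀ ζ : Circle → ℝ, ContMDiff (𝓡 1) 𝓘(ℝ, ℝ) ∞ ζ →
    ∫ p, u p * partialTheta ζ p ∂dtheta = -∫ p, v p * ζ p ∂dtheta

/-- `u ∈ H¹(𝕊¹)`. -/
def MemH1 (u : Circle → ℝ) : Prop :=
  MemLp u 2 dtheta ∧ ∃ v, MemLp v 2 dtheta ∧ IsWeakDeriv u v

open Classical in
/-- The weak derivative in `L²` of a function in `H¹(𝕊¹)`, which is determined up to a null set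
(and `0` for functions that are not in `H¹(𝕊¹)`). -/
def weakDeriv (u : Circle → ℝ) : Circle → ℝ :=
  if h : MemH1 u then Classical.choose h.2 else 0

/-- `u = log φ'`. -/
def logAngDeriv (φ : Equiv.Perm Circle) (p : Circle) : ℝ := Real.log (angDeriv φ p)

/-- The diffeomorphisms of class `C¹` with `log φ' ∈ H¹(𝕊¹)` and `∫ e^{log φ'} dθ = 2π`. -/
def HDiff : Set (DiffPlus 1) :=
  {φ | MemH1 (logAngDeriv φ.1) ∧ ∫ p, Real.exp (logAngDeriv φ.1 p) ∂dtheta = 2 * π}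

/-- `E[u] = ∫ ¼ (u')² - e^{2u} dθ`. -/
def energy (u : Circle → ℝ) : ℝ :=
  ∫ p, ((1 / 4 : ℝ) * weakDeriv u p ^ 2 - Real.exp (2 * u p)) ∂dtheta

/-- `E_G^*[φ] = E[log φ'] + 2π`. -/
def EGstar (φ : Equiv.Perm Circle) : ℝ := energy (logAngDeriv φ) + 2 * π

/-- The linear action of a matrix `L` on `ℝ² = ℂ`. -/
def linAct (L : Matrix.SpecialLinearGroup (Fin 2) ℝ) (z : ℂ) : ℂ :=
  ⟨L 0 0 * z.re + L 0 1 * z.im, L 1 0 * z.re + L 1 1 * z.im⟩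

/-- The Möbius group of the circle: the maps `x ↦ L x / |L x|` with `L ∈ SL(2, ℝ)`. -/
def Mob : Set (Equiv.Perm Circle) :=
  {φ | ∃ L : Matrix.SpecialLinearGroup (Fin 2) ℝ,
    ∀ p : Circle, (φ p : ℂ) = linAct L p / (‖linAct L p‖ : ℂ)}

/-- The inverse `ℝ → (0, π)` of the cotangent. -/
def arccot (x : ℝ) : ℝ := π / 2 - Real.arctan x

/-- The map `ψ_τ`: it is given by `θ(ψ_τ(p)) = arccot (τ + cot (θ(p) - π/2)) + π/2` on the half
circle `π/2 < θ(p) < 3π/2`, and by the identity on the rest of the circle (the end points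
`θ(p) = π/2, 3π/2`, where the cotangent is infinite, are fixed). -/
def psi (τ : ℝ) (p : Circle) : Circle :=
  if theta p ∈ Ioo (π / 2) (3 * π / 2) then
    Circle.exp (arccot (τ + Real.cot (theta p - π / 2)) + π / 2)
  else p

end

end OvalsBL

open OvalsBL

/-!
Let `Φ` be a lift of `φ` to the line and `u = log Φ'`, so that the energy is the integral of
`¼ u'² - e^{2u} + 1` over a period. If `φ` has at least four balance points, then
`Φ (t + π) = Φ t + π` holds at two points `p < q < p + π`. This survives in the limit, except that
the two points may merge; by Rolle's theorem, a limit point `p` of this kind is double in the sense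
that `u (p + π) = u p`. In this case put `q = p`.

The lower bound is a calibration. Let `c`, `d`, `C`, `D` be the cotangents of `Φ t - Φ p`,
`Φ t - Φ q`, `t - p`, `t - q`, and let `w` be the logarithm of
`Φ' t sin (t - p) sin (t - q) / (sin (Φ t - Φ p) sin (Φ t - Φ q))`, up to a constant; it vanishes
for Möbius maps. There is a function `L` with `L' = (1 + C D) (1 - e^w)`, and the density differs
from the derivative of `½ ((c + d) e^u - (C + D) (1 + w)) + L` by
`¼ w'² + ¼ (C - D)² (e^w - 1)² + ½ (2 + C² + D²) (e^w - 1 - w) ≥ 0`.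
At the zeros of the sines the calibrating function has limits, because `u ∈ H¹` satisfies
`u t - u s = o (√|t - s|)` as `t → s`.

If the energy vanishes, then `w = 0`. This is a differential equation for `Φ`, whose solutions are
given by Möbius maps; at a double point there is one constant of integration on each side, whence
`ψ_τ`. The parameter `τ` is a jump of `u'`, which regularity excludes.
-/

namespace OvalsBL

open Filter Topology Asymptotics

/-! ### Calibrations with singular points -/

section AbsolutelyContinuous

variable {f : ℝ → ℝ} {a b : ℝ}

theorem absolutelyContinuousOnInterval_comp_of_lipschitzOnWith {g : ℝ → ℝ} {s : Set ℝ} {K : NNReal}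
    (hg : LipschitzOnWith K g s) (hf : AbsolutelyContinuousOnInterval f a b)
    (hs : MapsTo f (uIcc a b) s) : AbsolutelyContinuousOnInterval (fun t => g (f t)) a b := by
  rw [absolutelyContinuousOnInterval_iff] at hf ⊢
  intro ε hε
  obtain ⟨δ, hδ, hsum⟩ := hf (ε / (K + 1)) (by positivity)
  refine ⟨δ, hδ, fun E hE hlen => ?_⟩
  calc ∑ i ∈ Finset.range E.1, dist (g (f (E.2 i).1)) (g (f (E.2 i).2))
      ≤ ∑ i ∈ Finset.range E.1, K * dist (f (E.2 i).1) (f (E.2 i).2) :=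
        Finset.sum_le_sum fun i hi =>
          hg.dist_le_mul _ (hs (hE.1 i hi).1) _ (hs (hE.1 i hi).2)
    _ = K * ∑ i ∈ Finset.range E.1, dist (f (E.2 i).1) (f (E.2 i).2) := by rw [Finset.mul_sum]
    _ ≤ K * (ε / (K + 1)) := by gcongr; exact (hsum E hE hlen).le
    _ < (K + 1) * (ε / (K + 1)) := by gcongr; linarith
    _ = ε := by field_simp

theorem exists_lipschitzOnWith_of_hasDerivAt {f' : ℝ → ℝ} {s : Set ℝ} (hs : Convex ℝ s)
    (hsc : IsCompact s) (hf : ∀ t ∈ s, HasDerivAt f (f' t) t) (hf' : ContinuousOn f' s) :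
    ∃ K, LipschitzOnWith K f s := by
  obtain ⟨K, hK⟩ := hsc.exists_bound_of_continuousOn hf'
  refine ⟨K.toNNReal, hs.lipschitzOnWith_of_nnnorm_hasDerivWithin_le
    (fun t ht => (hf t ht).hasDerivWithinAt) fun t ht => ?_⟩
  rw [← NNReal.coe_le_coe, coe_nnnorm]
  exact (hK t ht).trans (Real.le_coe_toNNReal K)

theorem absolutelyContinuousOnInterval_of_hasDerivAt {f' : ℝ → ℝ}
    (hf : ∀ t ∈ uIcc a b, HasDerivAt f (f' t) t) (hf' : ContinuousOn f' (uIcc a b)) :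
    AbsolutelyContinuousOnInterval f a b :=
  (exists_lipschitzOnWith_of_hasDerivAt (convex_uIcc a b) isCompact_uIcc hf hf').choose_spec
    |>.absolutelyContinuousOnInterval

theorem absolutelyContinuousOnInterval_const (c : ℝ) :
    AbsolutelyContinuousOnInterval (fun _ => c) a b :=
  absolutelyContinuousOnInterval_of_hasDerivAt (fun t _ => hasDerivAt_const t c) continuousOn_const

theorem absolutelyContinuousOnInterval_exp (hf : AbsolutelyContinuousOnInterval f a b) :
    AbsolutelyContinuousOnInterval (fun t => rexp (f t)) a b := by
  obtain ⟨K, hK⟩ := exists_lipschitzOnWith_of_hasDerivAt (s := f '' uIcc a b)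
    (isPreconnected_uIcc.image f hf.continuousOn).ordConnected.convex
    (isCompact_uIcc.image_of_continuousOn hf.continuousOn)
    (fun t _ => Real.hasDerivAt_exp t) Real.continuous_exp.continuousOn
  exact absolutelyContinuousOnInterval_comp_of_lipschitzOnWith hK hf (mapsTo_image f _)

end AbsolutelyContinuous

section Calibration

theorem dense_of_forall_mem_nhdsNE {X : Type*} [TopologicalSpace X] [∀ x : X, NeBot (𝓝[≠] x)]
    {U : Set X} (hU : ∀ x, U ∈ 𝓝[≠] x) : Dense U := fun x =>
  mem_closure_iff_frequently.2
    ((show ∀ᶠ y in 𝓝[≠] x, y ∈ U from hU x).frequently.filter_mono nhdsWithin_le_nhds)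

theorem monotone_of_le_of_Icc_subset_compl {G : ℝ → ℝ} {S : Set ℝ} (hG : Continuous G)
    (hS : ∀ x, Sᶜ ∈ 𝓝[≠] x) (h : ∀ a b, a ≤ b → Icc a b ⊆ Sᶜ → G a ≤ G b) : Monotone G := by
  have right : ∀ x, ∀ᶠ y in 𝓝[>] x, G x ≤ G y := fun x => by
    obtain ⟨c, hxc, hc⟩ := mem_nhdsGT_iff_exists_Ioo_subset.1
      (nhdsWithin_mono x (fun _ hy => ne_of_gt hy) (hS x))
    filter_upwards [Ioo_mem_nhdsGT hxc] with y hy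
    refine le_of_tendsto (hG.continuousWithinAt (s := Ioi x)) ?_
    filter_upwards [Ioo_mem_nhdsGT hy.1] with z hz
    exact h z y hz.2.le fun t ht => hc ⟨hz.1.trans_le ht.1, ht.2.trans_lt hy.2⟩
  intro a b hab
  have bound := image_le_of_liminf_slope_right_le_deriv_boundary (f := fun x => -G x)
    (B := fun _ => -G a) (B' := fun _ => 0) hG.neg.continuousOn le_rfl continuousOn_const
    (fun x _ => hasDerivWithinAt_const ..) (fun x _ r hr => ?_) (right_mem_Icc.2 hab)
  · exact neg_le_neg_iff.1 bound
  · refine Eventually.frequently ?_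
    filter_upwards [right x, self_mem_nhdsWithin] with y hy hxy
    refine lt_of_le_of_lt ?_ hr
    rw [slope_def_field]
    exact div_nonpos_of_nonpos_of_nonneg (by linarith) (sub_nonneg.2 (le_of_lt hxy))

theorem eq_of_hasDerivAt_zero_of_continuous {G : ℝ → ℝ} {S : Set ℝ} (hG : Continuous G)
    (hS : ∀ x, Sᶜ ∈ 𝓝[≠] x) (h : ∀ t ∉ S, HasDerivAt G 0 t) (a b : ℝ) : G a = G b := by
  have hconst : ∀ a b, a ≤ b → Icc a b ⊆ Sᶜ → G b = G a := fun a b hab habS =>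
    constant_of_has_deriv_right_zero hG.continuousOn
      (fun t ht => (h t (habS (Ico_subset_Icc_self ht))).hasDerivWithinAt) b (right_mem_Icc.2 hab)
  have hmono : Monotone G :=
    monotone_of_le_of_Icc_subset_compl hG hS fun a b hab habS => (hconst a b hab habS).ge
  have hanti : Monotone fun t => -G t := monotone_of_le_of_Icc_subset_compl hG.neg hS
    fun a b hab habS => neg_le_neg (hconst a b hab habS).le
  rcases le_total a b with hab | hab
  · exact le_antisymm (hmono hab) (neg_le_neg_iff.1 (hanti hab))
  · exact le_antisymm (neg_le_neg_iff.1 (hanti hab)) (hmono hab)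

theorem exists_tendsto_of_absolutelyContinuousOnInterval {T : ℝ → ℝ} {S : Set ℝ}
    (hS : IsClosed S) (hT : ∀ a b, uIcc a b ⊆ Sᶜ → AbsolutelyContinuousOnInterval T a b)
    (hlim : ∀ x ∈ S, ∃ L, Tendsto T (𝓝[≠] x) (𝓝 L)) (x : ℝ) :
    ∃ L, Tendsto T (𝓝[Sᶜ] x) (𝓝 L) := by
  by_cases hx : x ∈ S
  · exact (hlim x hx).imp fun L hL => hL.mono_left (nhdsWithin_mono x fun y hy h => hy (h ▸ hx))
  · obtain ⟨δ, hδ, hball⟩ := Metric.nhds_basis_closedBall.mem_iff.1 (hS.isOpen_compl.mem_nhds hx)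
    rw [Real.closedBall_eq_Icc, ← uIcc_of_le (by linarith)] at hball
    refine ⟨T x, ((hT _ _ hball).continuousOn.continuousAt ?_).tendsto.mono_left nhdsWithin_le_nhds⟩
    exact uIcc_of_le (show x - δ ≤ x + δ by linarith) ▸ Icc_mem_nhds (by linarith) (by linarith)

/-- `T` calibrates the density `e` off the singular set `S`, with defect `ρ`: there, `T' + ρ ≤ e`.
At the points of `S`, the function `T` is only required to have limits. -/
structure Calibrates (T ρ e : ℝ → ℝ) (S : Set ℝ) : Prop where
  absolutelyContinuous : ∀ a b, uIcc a b ⊆ Sᶜ → AbsolutelyContinuousOnInterval T a b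
  ae_deriv_add_le : ∀ᵐ t, t ∉ S → deriv T t + ρ t ≤ e t
  exists_tendsto : ∀ x, ∃ L, Tendsto T (𝓝[Sᶜ] x) (𝓝 L)

namespace Calibrates

variable {T ρ e : ℝ → ℝ} {S : Set ℝ} (hT : Calibrates T ρ e S)

include hT

theorem sub_add_integral_le (he : ∀ a b, IntervalIntegrable e volume a b)
    (hρ : ContinuousOn ρ Sᶜ) {a b : ℝ} (hab : a ≤ b) (habS : Icc a b ⊆ Sᶜ) :
    T b - T a + ∫ t in a..b, ρ t ≤ ∫ t in a..b, e t := by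
  rw [← uIcc_of_le hab] at habS
  have hTac := hT.absolutelyContinuous a b habS
  have hρi : IntervalIntegrable ρ volume a b := (hρ.mono habS).intervalIntegrable
  rw [← hTac.integral_deriv_eq_sub, ← intervalIntegral.integral_add hTac.intervalIntegrable_deriv
    hρi]
  refine intervalIntegral.integral_mono_ae_restrict hab (hTac.intervalIntegrable_deriv.add hρi)
    (he a b) ((ae_restrict_iff' measurableSet_Icc).2 ?_)
  filter_upwards [hT.ae_deriv_add_le] with t ht htab
  exact ht (habS (by rwa [uIcc_of_le hab]))

theorem extendFrom_apply {x : ℝ} (hx : x ∉ S) : extendFrom Sᶜ T x = T x := by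
  obtain ⟨L, hL⟩ := hT.exists_tendsto x
  rw [extendFrom_eq (subset_closure hx) hL]
  exact tendsto_nhds_unique (hL.mono_left (pure_le_nhdsWithin hx)) (tendsto_pure_nhds T x)

theorem monotone_integral_sub_extendFrom (he : ∀ a b, IntervalIntegrable e volume a b)
    (hρ : ContinuousOn ρ Sᶜ) (hρ0 : ∀ t, 0 ≤ ρ t) (hS : ∀ x, Sᶜ ∈ 𝓝[≠] x) :
    Monotone fun x => (∫ t in (0 : ℝ)..x, e t) - extendFrom Sᶜ T x := by
  have hcont := (intervalIntegral.continuous_primitive he 0).sub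
    (continuous_extendFrom (dense_of_forall_mem_nhdsNE hS) hT.exists_tendsto)
  refine monotone_of_le_of_Icc_subset_compl hcont hS fun a b hab habS => ?_
  have hle := hT.sub_add_integral_le he hρ hab habS
  have hρi := intervalIntegral.integral_nonneg (μ := volume) hab fun t _ => hρ0 t
  have hadd := intervalIntegral.integral_add_adjacent_intervals (he 0 a) (he a b)
  simp only [hT.extendFrom_apply (habS (left_mem_Icc.2 hab)),
    hT.extendFrom_apply (habS (right_mem_Icc.2 hab))]
  linarith

variable {P : ℝ} (hP : 0 < P) (he : ∀ a b, IntervalIntegrable e volume a b)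
  (heP : Function.Periodic e P) (hTP : Function.Periodic T P) (hSP : ∀ t, t + P ∈ S ↔ t ∈ S)
  (hρ : ContinuousOn ρ Sᶜ) (hρ0 : ∀ t, 0 ≤ ρ t) (hS : ∀ x, Sᶜ ∈ 𝓝[≠] x)

include heP hTP hSP he in
theorem integral_sub_extendFrom_add_period {x : ℝ} (hx : x ∉ S) :
    (∫ t in (0 : ℝ)..x + P, e t) - extendFrom Sᶜ T (x + P) =
      ((∫ t in (0 : ℝ)..x, e t) - extendFrom Sᶜ T x) + ∫ t in (0 : ℝ)..P, e t := by
  rw [hT.extendFrom_apply hx, hT.extendFrom_apply (mt (hSP x).1 hx), hTP x,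
    ← intervalIntegral.integral_add_adjacent_intervals (he 0 x) (he x (x + P)),
    heP.intervalIntegral_add_eq x 0, zero_add]
  ring

include hP he heP hTP hSP hρ hρ0 hS

theorem integral_nonneg : 0 ≤ ∫ t in (0 : ℝ)..P, e t := by
  have hmono := hT.monotone_integral_sub_extendFrom he hρ hρ0 hS
  obtain ⟨x, hx⟩ : ∃ x, x ∉ S :=
    (show ∀ᶠ y in 𝓝[≠] (0 : ℝ), y ∈ Sᶜ from hS 0).exists
  have hle := hmono (le_add_of_nonneg_right hP.le : x ≤ x + P)
  have hadd := hT.integral_sub_extendFrom_add_period he heP hTP hSP hx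
  simp only at hle
  linarith

theorem defect_eq_zero_of_integral_eq_zero (hSc : IsClosed S)
    (hE : ∫ t in (0 : ℝ)..P, e t = 0) {x : ℝ} (hx : x ∉ S) : ρ x = 0 := by
  have hmono := hT.monotone_integral_sub_extendFrom he hρ hρ0 hS
  obtain ⟨δ, hδ, hball⟩ := Metric.nhds_basis_closedBall.mem_iff.1 (hSc.isOpen_compl.mem_nhds hx)
  set r := min δ (P / 2)
  have hr : 0 < r := lt_min hδ (half_pos hP)
  have hIcc : Icc (x - r) (x + r) ⊆ Sᶜ := fun t ht => hball <| by
    rw [Real.closedBall_eq_Icc]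
    exact Icc_subset_Icc (by grind) (by grind) ht
  have hlt : x - r < x + r := by linarith
  have hleft : x - r ∉ S := hIcc (left_mem_Icc.2 hlt.le)
  have hle := hT.sub_add_integral_le he hρ hlt.le hIcc
  have hadd := intervalIntegral.integral_add_adjacent_intervals (he 0 (x - r)) (he (x - r) (x + r))
  have hper := hT.integral_sub_extendFrom_add_period he heP hTP hSP hleft
  have hback := hmono (show x + r ≤ x - r + P by grind)
  simp only [hT.extendFrom_apply hleft, hT.extendFrom_apply (hIcc (right_mem_Icc.2 hlt.le))]
    at hper hback
  by_contra hne
  have hpos := intervalIntegral.integral_pos hlt (hρ.mono hIcc) (fun t _ => hρ0 t)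
    ⟨x, ⟨by linarith, by linarith⟩, (hρ0 x).lt_of_ne' hne⟩
  linarith

end Calibrates
end Calibration

/-! ### Little Hölder continuity -/

/-- `k` is little Hölder continuous at `p` with exponent `1/2`, as functions in `H¹` are at every
point. The point of this class is that `e^k - 1 - k` is differentiable at the zeros of `k`. -/
def IsLittleHolderHalf (k : ℝ → ℝ) (p : ℝ) : Prop :=
  (fun t => k t - k p) =o[𝓝 p] fun t => √|t - p|

theorem isLittleO_mul_sqrt_abs_of_hasDerivAt {h h' : ℝ → ℝ} {p : ℝ}
    (hh : ∀ t, HasDerivAt h (h' t) t) (hp : h' =o[𝓝 p] fun t => √|t - p|) :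
    (fun t => h t - h p) =o[𝓝 p] fun t => (t - p) * √|t - p| := by
  refine IsLittleO.of_bound fun ε hε => ?_
  obtain ⟨δ, hδ, hball⟩ := Metric.eventually_nhds_iff_ball.1 (hp.bound hε)
  filter_upwards [Metric.ball_mem_nhds p hδ] with t ht
  have hbound : ∀ s ∈ uIcc p t, ‖h' s‖ ≤ ε * √|t - p| := fun s hs => by
    have hst : |s - p| ≤ |t - p| := abs_sub_left_of_mem_uIcc hs
    refine (hball s (hst.trans_lt ht)).trans ?_
    rw [Real.norm_of_nonneg (Real.sqrt_nonneg _)]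
    gcongr
  have hmvt := (convex_uIcc p t).norm_image_sub_le_of_norm_hasDerivWithin_le
    (fun s _ => (hh s).hasDerivWithinAt) hbound left_mem_uIcc right_mem_uIcc
  rw [norm_mul, Real.norm_of_nonneg (Real.sqrt_nonneg _)]
  linarith

namespace IsLittleHolderHalf

variable {k l : ℝ → ℝ} {p : ℝ}

theorem of_isBigO (hk : IsLittleHolderHalf k p)
    (hl : (fun t => l t - l p) =O[𝓝 p] fun t => k t - k p) : IsLittleHolderHalf l p :=
  hl.trans_isLittleO hk

theorem continuousAt (hk : IsLittleHolderHalf k p) : ContinuousAt k p := by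
  have hsqrt : Tendsto (fun t : ℝ => √|t - p|) (𝓝 p) (𝓝 0) :=
    Continuous.tendsto' (by fun_prop) _ _ (by simp)
  exact tendsto_sub_nhds_zero_iff.1 (IsLittleO.trans_tendsto hk hsqrt)

theorem add (hk : IsLittleHolderHalf k p) (hl : IsLittleHolderHalf l p) :
    IsLittleHolderHalf (fun t => k t + l t) p :=
  (IsLittleO.add hk hl).congr_left fun t => by ring

theorem comp_hasDerivAt {f : ℝ → ℝ} {f' : ℝ} (hk : IsLittleHolderHalf k p)
    (hf : HasDerivAt f f' (k p)) : IsLittleHolderHalf (fun t => f (k t)) p :=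
  hk.of_isBigO (hf.isBigO_sub.comp_tendsto hk.continuousAt)

theorem const_mul (hk : IsLittleHolderHalf k p) (c : ℝ) :
    IsLittleHolderHalf (fun t => c * k t) p :=
  hk.comp_hasDerivAt ((hasDerivAt_id _).const_mul c)

theorem sub (hk : IsLittleHolderHalf k p) (hl : IsLittleHolderHalf l p) :
    IsLittleHolderHalf (fun t => k t - l t) p :=
  (IsLittleO.sub hk hl).congr_left fun t => by ring

theorem mul (hk : IsLittleHolderHalf k p) (hl : IsLittleHolderHalf l p) :
    IsLittleHolderHalf (fun t => k t * l t) p := by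
  exact ((IsLittleO.mul_isBigO hk (hl.continuousAt.isBigO_one ℝ)).congr_right fun t => mul_one _)
    |>.add (IsLittleO.const_mul_left hl (k p)) |>.congr_left fun t => by ring

theorem of_hasDerivAt {k' : ℝ} (hk : HasDerivAt k k' p) : IsLittleHolderHalf k p := by
  refine hk.isBigO_sub.trans_isLittleO ?_
  have hsqrt : (fun t : ℝ => √|t - p|) =o[𝓝 p] fun _ => (1 : ℝ) :=
    (isLittleO_one_iff ℝ).2 (Continuous.tendsto' (by fun_prop) _ _ (by simp))
  refine ((hsqrt.mul_isBigO (isBigO_refl (fun t : ℝ => √|t - p|) (𝓝 p))).congr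
    (fun t => Real.mul_self_sqrt (abs_nonneg _)) fun t => one_mul _).of_abs_left

theorem exp_sub_one_sub_isLittleO (hk : IsLittleHolderHalf k p) (hp : k p = 0) :
    (fun t => rexp (k t) - 1 - k t) =o[𝓝 p] fun t => t - p := by
  have hsq : (fun t => k t ^ 2) =o[𝓝 p] fun t => t - p := by
    have := (IsLittleO.pow hk two_pos)
    simp only [hp, sub_zero, Real.sq_sqrt (abs_nonneg _)] at this
    exact this.of_abs_right
  refine IsBigO.trans_isLittleO (IsBigO.of_bound 1 ?_) hsq
  have hsmall : ∀ᶠ t in 𝓝 p, |k t| < 1 :=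
    hk.continuousAt.abs.eventually_lt continuousAt_const (by simp [hp])
  filter_upwards [hsmall] with t ht
  rw [one_mul, Real.norm_eq_abs, norm_pow, Real.norm_eq_abs, sq_abs]
  exact Real.abs_exp_sub_one_sub_id_le ht.le

theorem hasDerivAt_exp_sub_one_sub (hk : IsLittleHolderHalf k p) (hp : k p = 0) :
    HasDerivAt (fun t => rexp (k t) - 1 - k t) 0 p :=
  hasDerivAt_iff_isLittleO.2 <| (hk.exp_sub_one_sub_isLittleO hp).congr_left fun t => by simp [hp]

theorem of_mul_eq {Q f f' s s' : ℝ → ℝ} (hQ : ∀ t, Q t * s t = f t)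
    (hf : ∀ t, HasDerivAt f (f' t) t) (hs : ∀ t, HasDerivAt s (s' t) t)
    (hf' : IsLittleHolderHalf f' p) (hs' : IsLittleHolderHalf s' p) (hsp : s p = 0)
    (hs'p : s' p ≠ 0) (hQp : Q p * s' p = f' p) : IsLittleHolderHalf Q p := by
  have hder : (fun t => f' t - Q p * s' t) =o[𝓝 p] fun t => √|t - p| :=
    (IsLittleO.sub hf' (hs'.const_mul (Q p))).congr_left fun t => by rw [← hQp]; ring
  have hrem : (fun t => (Q t - Q p) * s t) =o[𝓝 p] fun t => (t - p) * √|t - p| :=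
    (isLittleO_mul_sqrt_abs_of_hasDerivAt (fun t => (hf t).sub ((hs t).const_mul (Q p)))
      hder).congr_left fun t => by simp only [Pi.sub_apply, ← hQ, hsp]; ring
  have hsub : (fun t => t - p) =O[𝓝 p] s :=
    (((hs p).isTheta_sub hs'p).isBigO_symm.comp_tendsto
      (tendsto_id.prodMk (tendsto_pure.2 (Eventually.of_forall fun _ => rfl)))).congr_right
      fun t => by simp [hsp]
  refine IsLittleO.of_bound fun ε hε => ?_
  filter_upwards [(((isBigO_refl (fun t => Q t - Q p) (𝓝 p)).mul hsub).trans_isLittleO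
    hrem).bound hε] with t ht
  rcases eq_or_ne t p with rfl | hne
  · simp
  · rw [norm_mul, norm_mul, mul_comm ‖t - p‖, ← mul_assoc] at ht
    exact le_of_mul_le_mul_right ht (norm_pos_iff.2 (sub_ne_zero.2 hne))

end IsLittleHolderHalf

theorem hasDerivAt_mul_of_continuousAt {f g : ℝ → ℝ} {g' x : ℝ} (hf : ContinuousAt f x)
    (hg : HasDerivAt g g' x) (hgx : g x = 0) : HasDerivAt (fun t => f t * g t) (f x * g') x := by
  refine hasDerivAt_iff_tendsto_slope.2
    (((hf.tendsto.mono_left nhdsWithin_le_nhds).mul hg.tendsto_slope).congr fun t => ?_)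
  simp only [slope_def_field, hgx]
  ring

theorem tendsto_div_of_hasDerivAt {f g : ℝ → ℝ} {f' g' x : ℝ} (hf : HasDerivAt f f' x)
    (hg : HasDerivAt g g' x) (hfx : f x = 0) (hgx : g x = 0) (hg' : g' ≠ 0) :
    Tendsto (fun t => f t / g t) (𝓝[≠] x) (𝓝 (f' / g')) := by
  refine (hf.tendsto_slope.div hg.tendsto_slope hg').congr' ?_
  filter_upwards [self_mem_nhdsWithin] with t ht
  rw [Pi.div_apply, slope_def_field, slope_def_field, hfx, hgx, sub_zero, sub_zero,
    div_div_div_cancel_right₀ (sub_ne_zero.2 ht)]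

theorem hasDerivAt_cot {x : ℝ} (hx : sin x ≠ 0) :
    HasDerivAt Real.cot (-(1 + Real.cot x ^ 2)) x := by
  refine (((Real.hasDerivAt_cos x).div (Real.hasDerivAt_sin x) hx).congr_deriv ?_)
    |>.congr_of_eventuallyEq (Eventually.of_forall Real.cot_eq_cos_div_sin)
  rw [Real.cot_eq_cos_div_sin]
  field_simp
  ring

/-! ### Lifts of circle diffeomorphisms -/

/-- `Φ` is a lift to the line of an orientation preserving diffeomorphism of the circle, with
`Φ' = e^u` and `u` a primitive of the locally square integrable function `v`. -/
structure CircleLift (Φ u v : ℝ → ℝ) : Prop where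
  hasDerivAt : ∀ t, HasDerivAt Φ (rexp (u t)) t
  add_two_pi : ∀ t, Φ (t + 2 * π) = Φ t + 2 * π
  intervalIntegrable : ∀ a b, IntervalIntegrable v volume a b
  intervalIntegrable_sq : ∀ a b, IntervalIntegrable (fun t => v t ^ 2) volume a b
  integral_eq_sub : ∀ a b, ∫ t in a..b, v t = u b - u a
  periodic : Function.Periodic v (2 * π)

/-- The density `¼ (u')² - e^{2u} + 1` of the energy. -/
noncomputable def eDensity (u v : ℝ → ℝ) (t : ℝ) : ℝ := 1 / 4 * v t ^ 2 - rexp (2 * u t) + 1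

namespace CircleLift

variable {Φ u v : ℝ → ℝ} (H : CircleLift Φ u v)

include H

theorem continuous : Continuous Φ :=
  continuous_iff_continuousAt.2 fun t => (H.hasDerivAt t).continuousAt

theorem strictMono : StrictMono Φ :=
  strictMono_of_deriv_pos fun x => (H.hasDerivAt x).deriv ▸ exp_pos _

theorem u_periodic : Function.Periodic u (2 * π) := fun t => by
  have hshift : HasDerivAt (fun x => Φ (x + 2 * π)) (rexp (u (t + 2 * π))) t :=
    (H.hasDerivAt (t + 2 * π)).comp_add_const t (2 * π)
  simp_rw [H.add_two_pi] at hshift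
  exact exp_injective (hshift.unique ((H.hasDerivAt t).add_const _))

theorem u_eq_integral_add (a : ℝ) : u = fun x => (∫ t in a..x, v t) + u a :=
  funext fun x => by rw [H.integral_eq_sub, sub_add_cancel]

theorem continuous_u : Continuous u := by
  rw [H.u_eq_integral_add 0]
  exact (intervalIntegral.continuous_primitive H.intervalIntegrable 0).add_const _

theorem ae_hasDerivAt : ∀ᵐ t, HasDerivAt u (v t) t := by
  have hloc : LocallyIntegrable v volume := fun x =>
    ⟨Ioo (x - 1) (x + 1), Ioo_mem_nhds (by linarith) (by linarith),
      (intervalIntegrable_iff_integrableOn_Ioo_of_le (by linarith)).1 (H.intervalIntegrable _ _)⟩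
  filter_upwards [LocallyIntegrable.ae_hasDerivAt_integral hloc] with t ht
  rw [H.u_eq_integral_add 0]
  exact (ht 0).add_const (u 0)

theorem absolutelyContinuous (a b : ℝ) : AbsolutelyContinuousOnInterval u a b := by
  rw [H.u_eq_integral_add a]
  exact ((H.intervalIntegrable a b).absolutelyContinuousOnInterval_intervalIntegral
    left_mem_uIcc).fun_add (absolutelyContinuousOnInterval_const _)

theorem intervalIntegrable_eDensity (a b : ℝ) :
    IntervalIntegrable (eDensity u v) volume a b := by
  have hcont : Continuous fun t => rexp (2 * u t) := by have := H.continuous_u; fun_prop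
  exact (((H.intervalIntegrable_sq a b).const_mul _).sub (hcont.intervalIntegrable a b)).add
    intervalIntegrable_const

theorem eDensity_periodic : Function.Periodic (eDensity u v) (2 * π) := fun t => by
  simp only [eDensity, H.periodic t, H.u_periodic t]

theorem sq_sub_le (a b : ℝ) : (u b - u a) ^ 2 ≤ |b - a| * |∫ t in a..b, v t ^ 2| := by
  wlog hab : a < b generalizing a b
  · rcases (not_lt.1 hab).eq_or_lt with rfl | hba
    · simp
    · rw [intervalIntegral.integral_symm, abs_neg, abs_sub_comm, ← neg_sub, neg_sq]
      exact this b a hba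
  rw [abs_of_pos (sub_pos.2 hab),
    abs_of_nonneg (intervalIntegral.integral_nonneg hab.le fun t _ => sq_nonneg _)]
  -- Expand the nonnegative integral of `(v - m)²`, with `m` the mean value of `v`.
  set m := (u b - u a) / (b - a)
  have hm : m * (b - a) = u b - u a := div_mul_cancel₀ _ (sub_pos.2 hab).ne'
  have hexpand : ∫ t in a..b, (v t - m) ^ 2
      = (∫ t in a..b, v t ^ 2) - 2 * m * (u b - u a) + m ^ 2 * (b - a) := by
    simp_rw [show ∀ t, (v t - m) ^ 2 = v t ^ 2 - 2 * m * v t + m ^ 2 from fun t => by ring]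
    have hsq := H.intervalIntegrable_sq a b
    have hlin := (H.intervalIntegrable a b).const_mul (2 * m)
    rw [intervalIntegral.integral_add (hsq.sub hlin) intervalIntegrable_const,
      intervalIntegral.integral_sub hsq hlin, intervalIntegral.integral_const_mul,
      H.integral_eq_sub, intervalIntegral.integral_const, smul_eq_mul]
    ring
  have hnonneg := intervalIntegral.integral_nonneg (μ := volume) hab.le
    fun t _ => sq_nonneg (v t - m)
  nlinarith [sub_pos.2 hab]

theorem isLittleHolderHalf (p : ℝ) : IsLittleHolderHalf u p := by
  have hint : Tendsto (fun t => √|∫ x in p..t, v x ^ 2|) (𝓝 p) (𝓝 0) :=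
    (intervalIntegral.continuous_primitive H.intervalIntegrable_sq p).abs.sqrt.tendsto' _ _
      (by simp)
  have hprod : (fun t => √|t - p| * √|∫ x in p..t, v x ^ 2|) =o[𝓝 p] fun t => √|t - p| := by
    simpa using (isBigO_refl (fun t : ℝ => √|t - p|) (𝓝 p)).mul_isLittleO
      ((isLittleO_one_iff ℝ).2 hint)
  refine IsBigO.trans_isLittleO (IsBigO.of_bound 1 (Eventually.of_forall fun t => ?_)) hprod
  rw [one_mul, ← Real.sqrt_mul (abs_nonneg _), Real.norm_eq_abs,
    Real.norm_of_nonneg (Real.sqrt_nonneg _)]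
  exact Real.abs_le_sqrt (H.sq_sub_le p t)

end CircleLift

theorem hasDerivAt_sin_sub (p t : ℝ) : HasDerivAt (fun t => sin (t - p)) (cos (t - p)) t := by
  simpa using ((hasDerivAt_id t).sub_const p).sin

theorem cos_ne_zero_of_sin_eq_zero {x : ℝ} (hx : sin x = 0) : cos x ≠ 0 := fun h => by
  simpa [hx, h] using Real.sin_sq_add_cos_sq x

theorem eventually_sin_sub_ne_zero (p x : ℝ) : ∀ᶠ t in 𝓝[≠] x, sin (t - p) ≠ 0 := by
  by_cases hx : sin (x - p) = 0
  · exact (hasDerivAt_sin_sub p x).eventually_ne (cos_ne_zero_of_sin_eq_zero hx)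
  · exact ((hasDerivAt_sin_sub p x).continuousAt.eventually_ne hx).filter_mono nhdsWithin_le_nhds

/-- The quotient `sin (Φ t - Φ p) / sin (t - p)`, extended by its limit `Φ' t` to the zeros of the
denominator (it is the limit if `p` is a balance point of `Φ`). -/
noncomputable def sinQuot (Φ : ℝ → ℝ) (p t : ℝ) : ℝ :=
  if sin (t - p) = 0 then deriv Φ t else sin (Φ t - Φ p) / sin (t - p)

/-- The logarithm of `sinQuot`. -/
noncomputable def logSinQuot (Φ : ℝ → ℝ) (p t : ℝ) : ℝ := log (sinQuot Φ p t)

namespace CircleLift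

variable {Φ u v : ℝ → ℝ} (H : CircleLift Φ u v) {p t : ℝ}

include H

theorem sub_periodic : Function.Periodic (fun t => Φ t - t) (2 * π) := fun t => by
  simp only [H.add_two_pi]
  ring

theorem add_int_mul_two_pi (t : ℝ) (n : ℤ) : Φ (t + n * (2 * π)) = Φ t + n * (2 * π) := by
  linarith [H.sub_periodic.int_mul n t]

variable (hp : Φ (p + π) = Φ p + π)

include hp

theorem balance_add_int_mul_pi (n : ℤ) : Φ (p + n * π) = Φ p + n * π := by
  obtain ⟨k, rfl | rfl⟩ := n.even_or_odd'
  · convert H.add_int_mul_two_pi p k using 2 <;> push_cast <;> ring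
  · rw [show p + ((2 * k + 1 : ℤ) : ℝ) * π = p + π + k * (2 * π) by push_cast; ring,
      H.add_int_mul_two_pi, hp]
    push_cast
    ring

theorem sub_eq_sub_of_sin_eq_zero (ht : sin (t - p) = 0) : Φ t - Φ p = t - p := by
  obtain ⟨n, hn⟩ := Real.sin_eq_zero_iff.1 ht
  rw [show t = p + n * π by linarith, H.balance_add_int_mul_pi hp]
  ring

theorem sin_div_sin_pos (ht : sin (t - p) ≠ 0) : 0 < sin (Φ t - Φ p) / sin (t - p) := by
  set n := ⌊(t - p) / π⌋
  have hlow : p + n * π < t := by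
    refine lt_of_le_of_ne ?_ fun h => ht ?_
    · linarith [(le_div_iff₀ pi_pos).1 (Int.floor_le ((t - p) / π))]
    · rw [← h, add_sub_cancel_left, Real.sin_int_mul_pi]
  have hupp : t < p + (n + 1 : ℤ) * π := by
    push_cast
    linarith [(div_lt_iff₀ pi_pos).1 (Int.lt_floor_add_one ((t - p) / π))]
  have hΦlow := H.strictMono hlow
  have hΦupp := H.strictMono hupp
  rw [H.balance_add_int_mul_pi hp] at hΦlow hΦupp
  push_cast at hupp hΦupp
  have hquot : 0 < sin (Φ t - Φ p - n * π) / sin (t - p - n * π) :=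
    div_pos (sin_pos_of_pos_of_lt_pi (by linarith) (by linarith))
      (sin_pos_of_pos_of_lt_pi (by linarith) (by linarith))
  rwa [Real.sin_sub_int_mul_pi, Real.sin_sub_int_mul_pi,
    mul_div_mul_left _ _ (zpow_ne_zero n (by norm_num))] at hquot

theorem sin_sub_ne_zero (ht : sin (t - p) ≠ 0) : sin (Φ t - Φ p) ≠ 0 := fun h => by
  simpa [h] using H.sin_div_sin_pos hp ht

theorem sinQuot_pos (t : ℝ) : 0 < sinQuot Φ p t := by
  unfold sinQuot
  split_ifs with ht
  · exact (H.hasDerivAt t).deriv ▸ exp_pos _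
  · exact H.sin_div_sin_pos hp ht

theorem sinQuot_mul_sin (t : ℝ) : sinQuot Φ p t * sin (t - p) = sin (Φ t - Φ p) := by
  unfold sinQuot
  split_ifs with ht
  · rw [H.sub_eq_sub_of_sin_eq_zero hp ht, ht, mul_zero]
  · exact div_mul_cancel₀ _ ht

theorem exp_logSinQuot (t : ℝ) : rexp (logSinQuot Φ p t) = sinQuot Φ p t :=
  exp_log (H.sinQuot_pos hp t)

omit hp in
theorem logSinQuot_of_sin_eq_zero (ht : sin (t - p) = 0) : logSinQuot Φ p t = u t := by
  rw [logSinQuot, sinQuot, if_pos ht, (H.hasDerivAt t).deriv, log_exp]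

theorem hasDerivAt_logSinQuot (ht : sin (t - p) ≠ 0) :
    HasDerivAt (logSinQuot Φ p) (cot (Φ t - Φ p) * rexp (u t) - cot (t - p)) t := by
  have hΦ := H.sin_sub_ne_zero hp ht
  have hsin : HasDerivAt (fun t => sin (Φ t - Φ p)) (cos (Φ t - Φ p) * rexp (u t)) t :=
    ((H.hasDerivAt t).sub_const (Φ p)).sin
  have hlog := (hsin.div (hasDerivAt_sin_sub p t) ht).log (H.sin_div_sin_pos hp ht).ne'
  refine (hlog.congr_deriv ?_).congr_of_eventuallyEq ?_
  · rw [Real.cot_eq_cos_div_sin, Real.cot_eq_cos_div_sin, Pi.div_apply]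
    field_simp
  · filter_upwards [(hasDerivAt_sin_sub p t).continuousAt.eventually_ne ht] with s hs
    rw [logSinQuot, sinQuot, if_neg hs, Pi.div_apply]

theorem isLittleHolderHalf_logSinQuot (t : ℝ) : IsLittleHolderHalf (logSinQuot Φ p) t := by
  by_cases ht : sin (t - p) = 0
  · have hcos : IsLittleHolderHalf (fun t => cos (Φ t - Φ p)) t :=
      .of_hasDerivAt ((H.hasDerivAt t).sub_const (Φ p)).cos
    have hquot : IsLittleHolderHalf (sinQuot Φ p) t := by
      refine .of_mul_eq (H.sinQuot_mul_sin hp)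
        (fun t => ((H.hasDerivAt t).sub_const (Φ p)).sin) (hasDerivAt_sin_sub p)
        (hcos.mul ((H.isLittleHolderHalf t).comp_hasDerivAt (Real.hasDerivAt_exp _)))
        (.of_hasDerivAt ((hasDerivAt_id t).sub_const p).cos) ht
        (cos_ne_zero_of_sin_eq_zero ht) ?_
      rw [← H.exp_logSinQuot hp, H.logSinQuot_of_sin_eq_zero ht,
        H.sub_eq_sub_of_sin_eq_zero hp ht, mul_comm]
    exact hquot.comp_hasDerivAt (Real.hasDerivAt_log (H.sinQuot_pos hp t).ne')
  · exact .of_hasDerivAt (H.hasDerivAt_logSinQuot hp ht)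

theorem continuous_logSinQuot : Continuous (logSinQuot Φ p) :=
  continuous_iff_continuousAt.2 fun t => (H.isLittleHolderHalf_logSinQuot hp t).continuousAt

omit hp in
theorem logSinQuot_periodic (p : ℝ) : Function.Periodic (logSinQuot Φ p) (2 * π) := fun t => by
  simp only [logSinQuot, sinQuot, (H.hasDerivAt _).deriv, H.u_periodic t, H.add_two_pi,
    add_sub_right_comm _ (2 * π), Real.sin_add_two_pi]

end CircleLift

/-! ### The calibration -/

theorem cot_sub_cot {x y : ℝ} (hx : sin x ≠ 0) (hy : sin y ≠ 0) :
    cot x - cot y = sin (y - x) / (sin x * sin y) := by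
  rw [Real.cot_eq_cos_div_sin, Real.cot_eq_cos_div_sin, div_sub_div _ _ hx hy, Real.sin_sub]
  ring

theorem one_add_cot_mul_cot {x y : ℝ} (hx : sin x ≠ 0) (hy : sin y ≠ 0) :
    1 + cot x * cot y = cos (y - x) / (sin x * sin y) := by
  rw [Real.cot_eq_cos_div_sin, Real.cot_eq_cos_div_sin, Real.cos_sub]
  field_simp
  ring

theorem one_add_cot_sq {x : ℝ} (hx : sin x ≠ 0) : 1 + cot x ^ 2 = 1 / sin x ^ 2 := by
  rw [sq, one_add_cot_mul_cot hx hx, sub_self, Real.cos_zero, sq]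

theorem cot_sub_add_two_pi (x y : ℝ) : cot (x + 2 * π - y) = cot (x - y) := by
  rw [add_sub_right_comm, Real.cot_eq_cos_div_sin, Real.cos_add_two_pi, Real.sin_add_two_pi,
    Real.cot_eq_cos_div_sin]

theorem hasDerivAt_cot_sub {p t : ℝ} (ht : sin (t - p) ≠ 0) :
    HasDerivAt (fun t => cot (t - p)) (-(1 + cot (t - p) ^ 2)) t :=
  (hasDerivAt_cot ht).comp_sub_const t p

theorem absolutelyContinuousOnInterval_cot_sub {p a b : ℝ}
    (hab : ∀ t ∈ uIcc a b, sin (t - p) ≠ 0) :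
    AbsolutelyContinuousOnInterval (fun t => cot (t - p)) a b := by
  have hder : ∀ t ∈ uIcc a b, HasDerivAt (fun t => cot (t - p)) (-(1 + cot (t - p) ^ 2)) t :=
    fun t ht => hasDerivAt_cot_sub (hab t ht)
  have hcont := HasDerivAt.continuousOn hder
  exact absolutelyContinuousOnInterval_of_hasDerivAt hder (by fun_prop)

/-- The points of the two lines through the base points `p` and `q`. -/
def singularSet (p q : ℝ) : Set ℝ := {t | sin (t - p) = 0 ∨ sin (t - q) = 0}

section SingularSet

variable {p q : ℝ}

theorem notMem_singularSet {t : ℝ} :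
    t ∉ singularSet p q ↔ sin (t - p) ≠ 0 ∧ sin (t - q) ≠ 0 := not_or

theorem isClosed_singularSet : IsClosed (singularSet p q) :=
  (isClosed_eq (by fun_prop) (by fun_prop)).union (isClosed_eq (by fun_prop) (by fun_prop))

theorem compl_singularSet_mem_nhdsNE (p q x : ℝ) : (singularSet p q)ᶜ ∈ 𝓝[≠] x := by
  filter_upwards [eventually_sin_sub_ne_zero p x, eventually_sin_sub_ne_zero q x] with t htp htq
  exact notMem_singularSet.2 ⟨htp, htq⟩

theorem dense_compl_singularSet (p q : ℝ) : Dense (singularSet p q)ᶜ :=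
  dense_of_forall_mem_nhdsNE (compl_singularSet_mem_nhdsNE p q)

theorem add_two_pi_mem_singularSet (t : ℝ) : t + 2 * π ∈ singularSet p q ↔ t ∈ singularSet p q := by
  simp only [singularSet, mem_ofPred_eq, add_sub_right_comm, Real.sin_add_two_pi]

end SingularSet

/-- Up to normalization at `p`, the logarithm of the ratio of `Φ' t` to the value it would have for
the lift of a Möbius map with the base points `p` and `q`; it vanishes exactly in the equality case
of the energy estimate. -/
noncomputable def balanceDefect (Φ u : ℝ → ℝ) (p q t : ℝ) : ℝ :=
  u t + logSinQuot Φ q p - logSinQuot Φ p t - logSinQuot Φ q t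

/-- The contribution of the base point `p` to `calibration`. -/
noncomputable def calibrationTerm (Φ u w : ℝ → ℝ) (p t : ℝ) : ℝ :=
  cot (Φ t - Φ p) * rexp (u t) - cot (t - p) * (1 + w t)

/-- The calibrating function with base points `p` and `q`, with a correction term `L` that depends
on whether the base points are distinct. -/
noncomputable def calibration (Φ u L : ℝ → ℝ) (p q t : ℝ) : ℝ :=
  1 / 2 * (calibrationTerm Φ u (balanceDefect Φ u p q) p t
    + calibrationTerm Φ u (balanceDefect Φ u p q) q t) + L t

namespace CircleLift

variable {Φ u v : ℝ → ℝ} (H : CircleLift Φ u v)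

include H

theorem hasDerivAt_cot_comp {p t : ℝ} (ht : sin (Φ t - Φ p) ≠ 0) :
    HasDerivAt (fun t => cot (Φ t - Φ p)) (-(1 + cot (Φ t - Φ p) ^ 2) * rexp (u t)) t :=
  HasDerivAt.comp (h := fun t => Φ t - Φ p) t (hasDerivAt_cot ht) ((H.hasDerivAt t).sub_const _)

theorem hasDerivAt_calibrationTerm {w : ℝ → ℝ} {p t v' w' : ℝ} (hu : HasDerivAt u v' t)
    (hw : HasDerivAt w w' t) (ht : sin (t - p) ≠ 0) (hΦt : sin (Φ t - Φ p) ≠ 0) :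
    HasDerivAt (calibrationTerm Φ u w p)
      (-(1 + cot (Φ t - Φ p) ^ 2) * rexp (u t) ^ 2 + cot (Φ t - Φ p) * rexp (u t) * v'
        + (1 + cot (t - p) ^ 2) * (1 + w t) - cot (t - p) * w') t :=
  (((H.hasDerivAt_cot_comp hΦt).mul hu.exp).sub
    ((hasDerivAt_cot_sub ht).mul (hw.const_add 1))).congr_deriv (by ring)

section TwoBasePoints

variable {p q : ℝ} (hp : Φ (p + π) = Φ p + π) (hq : Φ (q + π) = Φ q + π)

theorem calibration_periodic {L : ℝ → ℝ} (hL : Function.Periodic L (2 * π)) :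
    Function.Periodic (calibration Φ u L p q) (2 * π) := fun t => by
  simp only [calibration, calibrationTerm, balanceDefect, H.add_two_pi, cot_sub_add_two_pi,
    H.u_periodic t, H.logSinQuot_periodic p t, H.logSinQuot_periodic q t, hL t]

include hp hq

theorem isLittleHolderHalf_balanceDefect (t : ℝ) :
    IsLittleHolderHalf (balanceDefect Φ u p q) t :=
  (((H.isLittleHolderHalf t).add (.of_hasDerivAt (hasDerivAt_const t _))).sub
    (H.isLittleHolderHalf_logSinQuot hp t)).sub (H.isLittleHolderHalf_logSinQuot hq t)

theorem continuous_balanceDefect : Continuous (balanceDefect Φ u p q) :=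
  continuous_iff_continuousAt.2 fun t => (H.isLittleHolderHalf_balanceDefect hp hq t).continuousAt

theorem hasDerivAt_balanceDefect {t v' : ℝ} (hu : HasDerivAt u v' t) (ht : t ∉ singularSet p q) :
    HasDerivAt (balanceDefect Φ u p q) (v' - (cot (Φ t - Φ p) + cot (Φ t - Φ q)) * rexp (u t)
      + (cot (t - p) + cot (t - q))) t := by
  obtain ⟨htp, htq⟩ := notMem_singularSet.1 ht
  exact (((hu.add_const _).sub (H.hasDerivAt_logSinQuot hp htp)).sub
    (H.hasDerivAt_logSinQuot hq htq)).congr_deriv (by ring)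

theorem exp_balanceDefect (t : ℝ) : rexp (balanceDefect Φ u p q t) * sinQuot Φ p t * sinQuot Φ q t =
    rexp (u t) * sinQuot Φ q p := by
  rw [balanceDefect, Real.exp_sub, Real.exp_sub, Real.exp_add, H.exp_logSinQuot hp,
    H.exp_logSinQuot hq, H.exp_logSinQuot hq]
  have := (H.sinQuot_pos hp t).ne'
  have := (H.sinQuot_pos hq t).ne'
  field_simp

omit hq in
theorem absolutelyContinuous_cot_comp {a b : ℝ} (hab : ∀ t ∈ uIcc a b, sin (t - p) ≠ 0) :
    AbsolutelyContinuousOnInterval (fun t => cot (Φ t - Φ p)) a b := by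
  have hder : ∀ t ∈ uIcc a b, HasDerivAt (fun t => cot (Φ t - Φ p))
      (-(1 + cot (Φ t - Φ p) ^ 2) * rexp (u t)) t := fun t ht =>
    H.hasDerivAt_cot_comp (H.sin_sub_ne_zero hp (hab t ht))
  have hcont := HasDerivAt.continuousOn hder
  have hu := H.continuous_u
  exact absolutelyContinuousOnInterval_of_hasDerivAt hder (by fun_prop)

omit hq in
theorem absolutelyContinuous_logSinQuot {a b : ℝ} (hab : ∀ t ∈ uIcc a b, sin (t - p) ≠ 0) :
    AbsolutelyContinuousOnInterval (logSinQuot Φ p) a b := by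
  have hcont := (H.absolutelyContinuous_cot_comp hp hab).continuousOn
  have hcont' := (absolutelyContinuousOnInterval_cot_sub hab).continuousOn
  have hu := H.continuous_u
  exact absolutelyContinuousOnInterval_of_hasDerivAt
    (fun t ht => H.hasDerivAt_logSinQuot hp (hab t ht)) (by fun_prop)

omit hq in
theorem absolutelyContinuous_calibrationTerm {w : ℝ → ℝ} {a b : ℝ}
    (hw : AbsolutelyContinuousOnInterval w a b) (hab : ∀ t ∈ uIcc a b, sin (t - p) ≠ 0) :
    AbsolutelyContinuousOnInterval (calibrationTerm Φ u w p) a b :=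
  ((H.absolutelyContinuous_cot_comp hp hab).fun_mul
    (absolutelyContinuousOnInterval_exp (H.absolutelyContinuous a b))).fun_sub
    ((absolutelyContinuousOnInterval_cot_sub hab).fun_mul
      ((absolutelyContinuousOnInterval_const 1).fun_add hw))

theorem absolutelyContinuous_calibration {L : ℝ → ℝ} {a b : ℝ}
    (hL : AbsolutelyContinuousOnInterval L a b) (hab : uIcc a b ⊆ (singularSet p q)ᶜ) :
    AbsolutelyContinuousOnInterval (calibration Φ u L p q) a b := by
  have habp : ∀ t ∈ uIcc a b, sin (t - p) ≠ 0 := fun t ht => (notMem_singularSet.1 (hab ht)).1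
  have habq : ∀ t ∈ uIcc a b, sin (t - q) ≠ 0 := fun t ht => (notMem_singularSet.1 (hab ht)).2
  have hw : AbsolutelyContinuousOnInterval (balanceDefect Φ u p q) a b :=
    (((H.absolutelyContinuous a b).fun_add (absolutelyContinuousOnInterval_const _)).fun_sub
      (H.absolutelyContinuous_logSinQuot hp habp)).fun_sub
      (H.absolutelyContinuous_logSinQuot hq habq)
  exact (((H.absolutelyContinuous_calibrationTerm hp hw habp).fun_add
    (H.absolutelyContinuous_calibrationTerm hq hw habq)).const_mul _).fun_add hL

end TwoBasePoints

end CircleLift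

theorem exp_sub_one_sub_nonneg (x : ℝ) : 0 ≤ rexp x - 1 - x := by linarith [add_one_le_exp x]

/-- Here `c`, `d`, `C`, `D` stand for the cotangents of `Φ t - Φ p`, `Φ t - Φ q`, `t - p`, `t - q`,
and `E`, `W` for `e^u`, `e^w`. -/
theorem calibration_defect_identity {c d C D E W w v : ℝ} (h : (c - d) * E = (C - D) * W) :
    1 / 4 * v ^ 2 - E ^ 2 + 1 -
      (1 / 2 * ((-(1 + c ^ 2) * E ^ 2 + c * E * v + (1 + C ^ 2) * (1 + w)
          - C * (v - (c + d) * E + (C + D)))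
        + (-(1 + d ^ 2) * E ^ 2 + d * E * v + (1 + D ^ 2) * (1 + w)
          - D * (v - (c + d) * E + (C + D)))) + (1 + C * D) * (1 - W)) =
      1 / 4 * (v - (c + d) * E + (C + D)) ^ 2 + 1 / 4 * (C - D) ^ 2 * (W - 1) ^ 2
        + 1 / 2 * (2 + C ^ 2 + D ^ 2) * (W - 1 - w) := by
  linear_combination 1 / 4 * ((c - d) * E + (C - D) * W) * h

namespace CircleLift

variable {Φ u v : ℝ → ℝ} (H : CircleLift Φ u v) {p q : ℝ}
  (hp : Φ (p + π) = Φ p + π) (hq : Φ (q + π) = Φ q + π)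

include H hp hq

theorem cot_sub_cot_mul_exp {t : ℝ} (ht : t ∉ singularSet p q) :
    (cot (Φ t - Φ p) - cot (Φ t - Φ q)) * rexp (u t) =
      (cot (t - p) - cot (t - q)) * rexp (balanceDefect Φ u p q t) := by
  obtain ⟨htp, htq⟩ := notMem_singularSet.1 ht
  have hQp := (H.sinQuot_pos hp t).ne'
  have hQq := (H.sinQuot_pos hq t).ne'
  rw [cot_sub_cot htp htq, cot_sub_cot (H.sin_sub_ne_zero hp htp) (H.sin_sub_ne_zero hq htq),
    sub_sub_sub_cancel_left, sub_sub_sub_cancel_left, ← H.sinQuot_mul_sin hq p,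
    ← H.sinQuot_mul_sin hp t, ← H.sinQuot_mul_sin hq t]
  field_simp
  linear_combination -sin (p - q) * H.exp_balanceDefect hp hq t

section Calibration

variable {L : ℝ → ℝ} (hL : ∀ t ∉ singularSet p q, HasDerivAt L
    ((1 + cot (t - p) * cot (t - q)) * (1 - rexp (balanceDefect Φ u p q t))) t)

include hL

theorem hasDerivAt_calibration {t : ℝ} (hu : HasDerivAt u (v t) t) (ht : t ∉ singularSet p q) :
    HasDerivAt (calibration Φ u L p q)
      (eDensity u v t - (1 / 4 * (v t - (cot (Φ t - Φ p) + cot (Φ t - Φ q)) * rexp (u t)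
          + (cot (t - p) + cot (t - q))) ^ 2
        + 1 / 4 * (cot (t - p) - cot (t - q)) ^ 2 * (rexp (balanceDefect Φ u p q t) - 1) ^ 2
        + 1 / 2 * (2 + cot (t - p) ^ 2 + cot (t - q) ^ 2)
          * (rexp (balanceDefect Φ u p q t) - 1 - balanceDefect Φ u p q t))) t := by
  obtain ⟨htp, htq⟩ := notMem_singularSet.1 ht
  have hw := H.hasDerivAt_balanceDefect hp hq hu ht
  refine ((((H.hasDerivAt_calibrationTerm hu hw htp (H.sin_sub_ne_zero hp htp)).add
    (H.hasDerivAt_calibrationTerm hu hw htq (H.sin_sub_ne_zero hq htq))).const_mul (1 / 2)).add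
    (hL t ht)).congr_deriv ?_
  rw [eDensity, two_mul (u t), Real.exp_add, ← sq, ← calibration_defect_identity
    (H.cot_sub_cot_mul_exp hp hq ht)]
  ring

theorem calibrates_calibration
    (hlim : ∀ x ∈ singularSet p q, ∃ l, Tendsto (calibration Φ u L p q) (𝓝[≠] x) (𝓝 l)) :
    Calibrates (calibration Φ u L p q)
      (fun t => rexp (balanceDefect Φ u p q t) - 1 - balanceDefect Φ u p q t) (eDensity u v)
      (singularSet p q) := by
  have hac : ∀ a b, uIcc a b ⊆ (singularSet p q)ᶜ →
      AbsolutelyContinuousOnInterval (calibration Φ u L p q) a b := fun a b hab => by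
    have hcotp := (absolutelyContinuousOnInterval_cot_sub fun t ht =>
      (notMem_singularSet.1 (hab ht)).1).continuousOn
    have hcotq := (absolutelyContinuousOnInterval_cot_sub fun t ht =>
      (notMem_singularSet.1 (hab ht)).2).continuousOn
    have hw := H.continuous_balanceDefect hp hq
    exact H.absolutelyContinuous_calibration hp hq (absolutelyContinuousOnInterval_of_hasDerivAt
      (fun t ht => hL t (hab ht)) (by fun_prop)) hab
  refine ⟨hac, ?_, exists_tendsto_of_absolutelyContinuousOnInterval isClosed_singularSet hac hlim⟩
  filter_upwards [H.ae_hasDerivAt] with t hu ht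
  rw [(H.hasDerivAt_calibration hp hq hL hu ht).deriv]
  have hρ := exp_sub_one_sub_nonneg (balanceDefect Φ u p q t)
  have : 0 ≤ 1 / 4 * (v t - (cot (Φ t - Φ p) + cot (Φ t - Φ q)) * rexp (u t)
      + (cot (t - p) + cot (t - q))) ^ 2
      + 1 / 4 * (cot (t - p) - cot (t - q)) ^ 2 * (rexp (balanceDefect Φ u p q t) - 1) ^ 2
      + 1 / 2 * (cot (t - p) ^ 2 + cot (t - q) ^ 2)
        * (rexp (balanceDefect Φ u p q t) - 1 - balanceDefect Φ u p q t) := by positivity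
  linarith

variable (hLP : Function.Periodic L (2 * π))
  (hlim : ∀ x ∈ singularSet p q, ∃ l, Tendsto (calibration Φ u L p q) (𝓝[≠] x) (𝓝 l))

include hLP hlim

theorem integral_eDensity_nonneg_of_calibration : 0 ≤ ∫ t in (0 : ℝ)..2 * π, eDensity u v t := by
  have hw := H.continuous_balanceDefect hp hq
  exact (H.calibrates_calibration hp hq hL hlim).integral_nonneg two_pi_pos
    H.intervalIntegrable_eDensity H.eDensity_periodic (H.calibration_periodic hLP)
    add_two_pi_mem_singularSet (by fun_prop) (fun t => exp_sub_one_sub_nonneg _)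
    (compl_singularSet_mem_nhdsNE p q)

theorem balanceDefect_eq_zero_of_integral_eq_zero
    (hE : ∫ t in (0 : ℝ)..2 * π, eDensity u v t = 0) : balanceDefect Φ u p q = 0 := by
  have hw := H.continuous_balanceDefect hp hq
  refine hw.ext_on (dense_compl_singularSet p q) continuous_zero fun t ht => ?_
  have hρ := (H.calibrates_calibration hp hq hL hlim).defect_eq_zero_of_integral_eq_zero two_pi_pos
    H.intervalIntegrable_eDensity H.eDensity_periodic (H.calibration_periodic hLP)
    add_two_pi_mem_singularSet (by fun_prop) (fun t => exp_sub_one_sub_nonneg _)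
    (compl_singularSet_mem_nhdsNE p q) isClosed_singularSet hE ht
  by_contra hne
  linarith [add_one_lt_exp hne]

end Calibration

end CircleLift

/-- The correction term of `calibration` for base points `p` and `q` on distinct lines. -/
noncomputable def distinctCorrection (Φ : ℝ → ℝ) (p q t : ℝ) : ℝ :=
  cot (q - p) * (logSinQuot Φ p t - logSinQuot Φ q t)

namespace CircleLift

variable {Φ u v : ℝ → ℝ} (H : CircleLift Φ u v) {p q : ℝ}
  (hp : Φ (p + π) = Φ p + π) (hq : Φ (q + π) = Φ q + π) (hpq : sin (p - q) ≠ 0)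

include H

section

variable {x : ℝ} (hx : sin (x - p) = 0)

include hpq hx

omit H in
theorem sin_sub_ne_zero_of_sin_sub_eq_zero : sin (x - q) ≠ 0 := by
  rw [← sub_add_sub_cancel x p q, Real.sin_add, hx, zero_mul, zero_add]
  exact mul_ne_zero (cos_ne_zero_of_sin_eq_zero hx) hpq

include hp

theorem logSinQuot_eq_of_sin_sub_eq_zero : logSinQuot Φ q x = logSinQuot Φ q p := by
  rw [logSinQuot, logSinQuot, sinQuot, sinQuot, if_neg hpq,
    if_neg (sin_sub_ne_zero_of_sin_sub_eq_zero hpq hx)]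
  obtain ⟨n, hn⟩ := Real.sin_eq_zero_iff.1 hx
  rw [show x = p + n * π by linarith, H.balance_add_int_mul_pi hp, add_sub_right_comm,
    add_sub_right_comm, Real.sin_add_int_mul_pi, Real.sin_add_int_mul_pi,
    mul_div_mul_left _ _ (zpow_ne_zero n (by norm_num))]

theorem balanceDefect_eq_zero_of_sin_sub_eq_zero : balanceDefect Φ u p q x = 0 := by
  rw [balanceDefect, H.logSinQuot_of_sin_eq_zero hx,
    H.logSinQuot_eq_of_sin_sub_eq_zero hp hpq hx]
  ring

include hq

theorem exists_tendsto_calibrationTerm :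
    ∃ l, Tendsto (calibrationTerm Φ u (balanceDefect Φ u p q) p) (𝓝[≠] x) (𝓝 l) := by
  set w := balanceDefect Φ u p q with hw
  set K : ℝ → ℝ := fun t => rexp (logSinQuot Φ q t - logSinQuot Φ q p) with hK
  have hxq := sin_sub_ne_zero_of_sin_sub_eq_zero hpq hx
  have hwx : w x = 0 := H.balanceDefect_eq_zero_of_sin_sub_eq_zero hp hpq hx
  have hKx : K x = 1 := by
    simp only [hK]
    rw [H.logSinQuot_eq_of_sin_sub_eq_zero hp hpq hx, sub_self, Real.exp_zero]
  have hexp : rexp (w x) - 1 - w x = 0 := by simp [hwx]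
  have hdiff : cos (Φ x - Φ p) * K x - cos (x - p) = 0 := by
    rw [hKx, H.sub_eq_sub_of_sin_eq_zero hp hx, mul_one, sub_self]
  have hcosK : HasDerivAt (fun t => cos (Φ t - Φ p) * K t) _ x :=
    ((H.hasDerivAt x).sub_const (Φ p)).cos.mul ((H.hasDerivAt_logSinQuot hq hxq).sub_const _).exp
  have hcos : HasDerivAt (fun t => cos (t - p)) _ x := ((hasDerivAt_id x).sub_const p).cos
  have hnum : HasDerivAt (fun t => cos (Φ t - Φ p) * K t * (rexp (w t) - 1 - w t)
      + (1 + w t) * (cos (Φ t - Φ p) * K t - cos (t - p))) _ x :=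
    (hasDerivAt_mul_of_continuousAt hcosK.continuousAt
      ((H.isLittleHolderHalf_balanceDefect hp hq x).hasDerivAt_exp_sub_one_sub hwx)
      hexp).add (hasDerivAt_mul_of_continuousAt
      ((H.continuous_balanceDefect hp hq).continuousAt.const_add 1) (hcosK.sub hcos) hdiff)
  refine ⟨_, (tendsto_div_of_hasDerivAt hnum (hasDerivAt_sin_sub p x) ?_ hx
    (cos_ne_zero_of_sin_eq_zero hx)).congr' ?_⟩
  · rw [hexp, hdiff, mul_zero, mul_zero, add_zero]
  filter_upwards [eventually_sin_sub_ne_zero p x] with t ht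
  have hu : rexp (u t) = rexp (w t) * K t * sinQuot Φ p t := by
    rw [← H.exp_logSinQuot hp, hw, hK, balanceDefect, ← Real.exp_add, ← Real.exp_add]
    ring_nf
  have hQ := (H.sinQuot_pos hp t).ne'
  rw [calibrationTerm, Real.cot_eq_cos_div_sin, Real.cot_eq_cos_div_sin, ← H.sinQuot_mul_sin hp, hu]
  field_simp
  ring

end

include hpq

omit H in
theorem logSinQuot_comm : logSinQuot Φ q p = logSinQuot Φ p q := by
  have hqp : sin (q - p) ≠ 0 := by rwa [← neg_sub, Real.sin_neg, neg_ne_zero]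
  rw [logSinQuot, logSinQuot, sinQuot, sinQuot, if_neg hpq, if_neg hqp, ← neg_sub (Φ p),
    ← neg_sub p, Real.sin_neg, Real.sin_neg, neg_div_neg_eq]

omit H in
theorem balanceDefect_comm : balanceDefect Φ u p q = balanceDefect Φ u q p := funext fun t => by
  rw [balanceDefect, balanceDefect, logSinQuot_comm hpq]
  ring

omit H hpq in
theorem continuousAt_calibrationTerm {w : ℝ → ℝ} (hw : Continuous w) {x : ℝ}
    (hx : sin (x - p) ≠ 0) (hΦx : sin (Φ x - Φ p) ≠ 0) (H : CircleLift Φ u v) :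
    ContinuousAt (calibrationTerm Φ u w p) x := by
  have := (H.hasDerivAt_cot_comp hΦx).continuousAt
  have := (hasDerivAt_cot_sub hx).continuousAt
  have := H.continuous_u
  unfold calibrationTerm
  fun_prop

include hp hq

theorem exists_tendsto_calibration_distinct {x : ℝ} (hx : x ∈ singularSet p q) :
    ∃ l, Tendsto (calibration Φ u (distinctCorrection Φ p q) p q) (𝓝[≠] x) (𝓝 l) := by
  have hw := H.continuous_balanceDefect hp hq
  have hqp : sin (q - p) ≠ 0 := by rwa [← neg_sub, Real.sin_neg, neg_ne_zero]
  have hL : Tendsto (distinctCorrection Φ p q) (𝓝[≠] x) (𝓝 (distinctCorrection Φ p q x)) :=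
    (((H.continuous_logSinQuot hp).sub (H.continuous_logSinQuot hq)).const_mul _).continuousAt
      |>.tendsto.mono_left nhdsWithin_le_nhds
  rcases hx with hx | hx
  · have hxq := sin_sub_ne_zero_of_sin_sub_eq_zero hpq hx
    obtain ⟨l, hl⟩ := H.exists_tendsto_calibrationTerm hp hq hpq hx
    exact ⟨_, ((hl.add ((H.continuousAt_calibrationTerm hw hxq (H.sin_sub_ne_zero hq hxq)).tendsto
      |>.mono_left nhdsWithin_le_nhds)).const_mul _).add hL⟩
  · have hxp := sin_sub_ne_zero_of_sin_sub_eq_zero hqp hx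
    obtain ⟨l, hl⟩ := H.exists_tendsto_calibrationTerm hq hp hqp hx
    rw [balanceDefect_comm hqp] at hl
    exact ⟨_, ((((H.continuousAt_calibrationTerm hw hxp (H.sin_sub_ne_zero hp hxp)).tendsto
      |>.mono_left nhdsWithin_le_nhds).add hl).const_mul _).add hL⟩

omit hpq in
theorem hasDerivAt_logSinQuot_sub {t : ℝ} (ht : t ∉ singularSet p q) :
    HasDerivAt (fun t => logSinQuot Φ p t - logSinQuot Φ q t)
      ((cot (t - p) - cot (t - q)) * (rexp (balanceDefect Φ u p q t) - 1)) t := by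
  obtain ⟨htp, htq⟩ := notMem_singularSet.1 ht
  refine ((H.hasDerivAt_logSinQuot hp htp).sub (H.hasDerivAt_logSinQuot hq htq)).congr_deriv ?_
  linear_combination H.cot_sub_cot_mul_exp hp hq ht

theorem hasDerivAt_distinctCorrection {t : ℝ} (ht : t ∉ singularSet p q) :
    HasDerivAt (distinctCorrection Φ p q)
      ((1 + cot (t - p) * cot (t - q)) * (1 - rexp (balanceDefect Φ u p q t))) t := by
  obtain ⟨htp, htq⟩ := notMem_singularSet.1 ht
  refine ((H.hasDerivAt_logSinQuot_sub hp hq ht).const_mul _).congr_deriv ?_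
  have hm : cot (q - p) * (cot (t - p) - cot (t - q)) = -(1 + cot (t - p) * cot (t - q)) := by
    rw [cot_sub_cot htp htq, one_add_cot_mul_cot htp htq, sub_sub_sub_cancel_left, ← neg_sub p q,
      Real.cot_eq_cos_div_sin, Real.cos_neg, Real.sin_neg]
    field_simp
  linear_combination (rexp (balanceDefect Φ u p q t) - 1) * hm

omit hp hq hpq in
theorem distinctCorrection_periodic : Function.Periodic (distinctCorrection Φ p q) (2 * π) :=
  fun t => by rw [distinctCorrection, H.logSinQuot_periodic p t, H.logSinQuot_periodic q t]; rfl

theorem integral_eDensity_nonneg_of_distinct : 0 ≤ ∫ t in (0 : ℝ)..2 * π, eDensity u v t :=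
  H.integral_eDensity_nonneg_of_calibration hp hq
    (fun _ => H.hasDerivAt_distinctCorrection hp hq hpq) H.distinctCorrection_periodic
    fun _ => H.exists_tendsto_calibration_distinct hp hq hpq

theorem logSinQuot_sub_eq_of_integral_eq_zero
    (hE : ∫ t in (0 : ℝ)..2 * π, eDensity u v t = 0) (s t : ℝ) :
    logSinQuot Φ p s - logSinQuot Φ q s = logSinQuot Φ p t - logSinQuot Φ q t := by
  have hw := H.balanceDefect_eq_zero_of_integral_eq_zero hp hq
    (fun _ => H.hasDerivAt_distinctCorrection hp hq hpq) H.distinctCorrection_periodic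
    (fun _ => H.exists_tendsto_calibration_distinct hp hq hpq) hE
  refine eq_of_hasDerivAt_zero_of_continuous (G := fun t => logSinQuot Φ p t - logSinQuot Φ q t)
    ((H.continuous_logSinQuot hp).sub (H.continuous_logSinQuot hq))
    (compl_singularSet_mem_nhdsNE p q) (fun t ht => ?_) s t
  simpa [hw] using H.hasDerivAt_logSinQuot_sub hp hq ht

end CircleLift

/-- The correction term of `calibration` for a double base point `p`. -/
noncomputable def doubleCorrection (Φ u : ℝ → ℝ) (p t : ℝ) : ℝ :=
  cot (Φ t - Φ p) * rexp (u p) - cot (t - p)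

namespace CircleLift

variable {Φ u v : ℝ → ℝ} (H : CircleLift Φ u v) {p : ℝ}

include H

theorem doubleCorrection_periodic : Function.Periodic (doubleCorrection Φ u p) (2 * π) :=
  fun t => by
    rw [doubleCorrection, H.add_two_pi, cot_sub_add_two_pi, cot_sub_add_two_pi, doubleCorrection]

variable (hp : Φ (p + π) = Φ p + π)

include hp

theorem hasDerivAt_doubleCorrection {t : ℝ} (ht : t ∉ singularSet p p) :
    HasDerivAt (doubleCorrection Φ u p)
      ((1 + cot (t - p) * cot (t - p)) * (1 - rexp (balanceDefect Φ u p p t))) t := by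
  have htp := (notMem_singularSet.1 ht).1
  have hΦt := H.sin_sub_ne_zero hp htp
  refine (((H.hasDerivAt_cot_comp hΦt).mul_const _).sub (hasDerivAt_cot_sub htp)).congr_deriv ?_
  have hQ := (H.sinQuot_pos hp t).ne'
  have hQp : sinQuot Φ p p = rexp (u p) := by
    rw [← H.exp_logSinQuot hp, H.logSinQuot_of_sin_eq_zero (by simp)]
  have hw := H.exp_balanceDefect hp hp t
  rw [hQp] at hw
  rw [← sq, one_add_cot_sq htp, one_add_cot_sq hΦt, ← H.sinQuot_mul_sin hp]
  field_simp
  linear_combination hw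

/-- The numerator is differentiable at the zeros of the denominator, although `u` need not be. -/
theorem calibration_double_eq {t : ℝ} (ht : sin (t - p) ≠ 0) :
    calibration Φ u (doubleCorrection Φ u p) p p t =
      (cos (Φ t - Φ p) * ((rexp (logSinQuot Φ p t - u p + balanceDefect Φ u p p t) - 1
          - (logSinQuot Φ p t - u p + balanceDefect Φ u p p t))
        + (rexp (u p - logSinQuot Φ p t) - 1 - (u p - logSinQuot Φ p t)))
      + (2 + balanceDefect Φ u p p t) * (cos (Φ t - Φ p) - cos (t - p))) / sin (t - p) := by
  have hQ := (H.sinQuot_pos hp t).ne'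
  have hup : rexp (u p) = sinQuot Φ p t * rexp (u p - logSinQuot Φ p t) := by
    rw [← H.exp_logSinQuot hp, ← Real.exp_add, add_sub_cancel]
  have hut : rexp (u t) =
      sinQuot Φ p t * rexp (logSinQuot Φ p t - u p + balanceDefect Φ u p p t) := by
    rw [← H.exp_logSinQuot hp, ← Real.exp_add, balanceDefect,
      H.logSinQuot_of_sin_eq_zero (t := p) (by simp)]
    ring_nf
  rw [calibration, calibrationTerm, doubleCorrection, Real.cot_eq_cos_div_sin,
    Real.cot_eq_cos_div_sin, ← H.sinQuot_mul_sin hp, hut, hup]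
  field_simp
  ring

section

variable (hu : u (p + π) = u p) {x : ℝ} (hx : sin (x - p) = 0)

include hu hx

omit hp in
theorem u_eq_of_sin_sub_eq_zero : u x = u p := by
  obtain ⟨n, hn⟩ := Real.sin_eq_zero_iff.1 hx
  obtain ⟨k, rfl | rfl⟩ := n.even_or_odd'
  · rw [show x = p + k * (2 * π) by push_cast at hn; linarith]
    exact H.u_periodic.int_mul k p
  · rw [show x = p + π + k * (2 * π) by push_cast at hn; linarith, ← hu]
    exact H.u_periodic.int_mul k (p + π)

theorem exists_tendsto_calibration_double :
    ∃ l, Tendsto (calibration Φ u (doubleCorrection Φ u p) p p) (𝓝[≠] x) (𝓝 l) := by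
  have hYx := H.logSinQuot_of_sin_eq_zero hx
  have hux := H.u_eq_of_sin_sub_eq_zero hu hx
  have hwx : balanceDefect Φ u p p x = 0 := by
    rw [balanceDefect, hYx, H.logSinQuot_of_sin_eq_zero (t := p) (by simp), hux]
    ring
  have hY := H.isLittleHolderHalf_logSinQuot hp x
  have hup : IsLittleHolderHalf (fun _ => u p) x := .of_hasDerivAt (hasDerivAt_const x _)
  have hcosΦ := ((H.hasDerivAt x).sub_const (Φ p)).cos
  have hcos := ((hasDerivAt_id x).sub_const p).cos
  have hexp := (((hY.sub hup).add (H.isLittleHolderHalf_balanceDefect hp hp x)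
    |>.hasDerivAt_exp_sub_one_sub (by simp [hYx, hux, hwx])).add
    ((hup.sub hY).hasDerivAt_exp_sub_one_sub (by simp [hYx, hux])))
  have hnum := (hasDerivAt_mul_of_continuousAt hcosΦ.continuousAt hexp
    (by simp [hYx, hux, hwx])).add (hasDerivAt_mul_of_continuousAt
      ((H.continuous_balanceDefect hp hp).continuousAt.const_add 2) (hcosΦ.sub hcos)
      (by simp [H.sub_eq_sub_of_sin_eq_zero hp hx]))
  refine ⟨_, (tendsto_div_of_hasDerivAt hnum (hasDerivAt_sin_sub p x) ?_ hx
    (cos_ne_zero_of_sin_eq_zero hx)).congr' ?_⟩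
  · simp [hYx, hux, hwx, H.sub_eq_sub_of_sin_eq_zero hp hx]
  filter_upwards [eventually_sin_sub_ne_zero p x] with t ht
  simp only [H.calibration_double_eq hp ht, Pi.add_apply, Pi.sub_apply, id]

end

variable (hu : u (p + π) = u p)

include hu

theorem integral_eDensity_nonneg_of_double : 0 ≤ ∫ t in (0 : ℝ)..2 * π, eDensity u v t :=
  H.integral_eDensity_nonneg_of_calibration hp hp
    (fun _ => H.hasDerivAt_doubleCorrection hp) H.doubleCorrection_periodic
    fun _ hx => H.exists_tendsto_calibration_double hp hu (or_self_iff.1 hx)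

theorem balanceDefect_eq_zero_of_double (hE : ∫ t in (0 : ℝ)..2 * π, eDensity u v t = 0) :
    balanceDefect Φ u p p = 0 :=
  H.balanceDefect_eq_zero_of_integral_eq_zero hp hp
    (fun _ => H.hasDerivAt_doubleCorrection hp) H.doubleCorrection_periodic
    (fun _ hx => H.exists_tendsto_calibration_double hp hu (or_self_iff.1 hx)) hE

end CircleLift

/-! ### The equality case -/

/-- `Φ` lifts a map of the circle which, up to rotations and positive factors, is the piecewise
linear map of the plane that sends the vector with coordinates `sin (t - p)` and `cos (t - p)` to
the one with coordinates `sin (t - p)` and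
`κ * cos (t - p) + c * sin (t - p) + τ * max (sin (t - p)) 0`. -/
structure IsShearLift (Φ : ℝ → ℝ) (p κ c τ : ℝ) : Prop where
  balance : Φ (p + π) = Φ p + π
  cos_eq : ∀ t, cos (Φ t - Φ p) =
    sinQuot Φ p t * (κ * cos (t - p) + c * sin (t - p) + τ * max (sin (t - p)) 0)

theorem exists_eq_add_ite_of_hasDerivAt_zero {K : ℝ → ℝ} {p : ℝ}
    (hK : ∀ t, sin (t - p) ≠ 0 → HasDerivAt K 0 t) (hper : Function.Periodic K (2 * π)) :
    ∃ a b, ∀ t, sin (t - p) ≠ 0 → K t = a + if 0 < sin (t - p) then b else 0 := by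
  have hconst : ∀ U : Set ℝ, IsOpen U → IsPreconnected U → (∀ t ∈ U, sin (t - p) ≠ 0) →
      ∀ s ∈ U, ∀ t ∈ U, K s = K t := fun U hU hU' hUp s hs t ht =>
    hU.is_const_of_deriv_eq_zero hU' (fun r hr => (hK r (hUp r hr)).differentiableAt
      |>.differentiableWithinAt) (fun r hr => (hK r (hUp r hr)).deriv) hs ht
  have hneg : ∀ t ∈ Ioo (p - π) p, sin (t - p) < 0 := fun t ht =>
    sin_neg_of_neg_of_neg_pi_lt (by linarith [ht.2]) (by linarith [ht.1])
  have hpos : ∀ t ∈ Ioo p (p + π), 0 < sin (t - p) := fun t ht =>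
    sin_pos_of_pos_of_lt_pi (by linarith [ht.1]) (by linarith [ht.2])
  refine ⟨K (p - π / 2), K (p + π / 2) - K (p - π / 2), fun t ht => ?_⟩
  have hpair : Function.Periodic (fun t => (K t, sin (t - p))) (2 * π) := fun t => by
    simp only [hper t, add_sub_right_comm t, Real.sin_add_two_pi]
  obtain ⟨s, hs, hst⟩ := hpair.exists_mem_Ico two_pi_pos t (p - π)
  obtain ⟨hKs, hsin⟩ := Prod.mk.inj hst
  rw [hsin] at ht ⊢
  rw [hKs]
  rcases lt_trichotomy s p with hsp | rfl | hsp
  · have hs' : s ∈ Ioo (p - π) p := ⟨hs.1.lt_of_ne fun h => ht (by simp [← h]), hsp⟩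
    rw [if_neg (hneg s hs').not_gt, add_zero]
    exact hconst _ isOpen_Ioo isPreconnected_Ioo (fun t ht => (hneg t ht).ne) s hs' _
      ⟨by linarith [pi_pos], by linarith [pi_pos]⟩
  · simp at ht
  · have hs' : s ∈ Ioo p (p + π) := ⟨hsp, by linarith [hs.2]⟩
    rw [if_pos (hpos s hs'), add_sub_cancel]
    exact hconst _ isOpen_Ioo isPreconnected_Ioo (fun t ht => (hpos t ht).ne') s hs' _
      ⟨by linarith [pi_pos], by linarith [pi_pos]⟩

namespace CircleLift

variable {Φ u v : ℝ → ℝ} (H : CircleLift Φ u v) {p q : ℝ}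

include H

theorem continuous_sinQuot (hp : Φ (p + π) = Φ p + π) : Continuous (sinQuot Φ p) :=
  (Real.continuous_exp.comp (H.continuous_logSinQuot hp)).congr fun t => H.exp_logSinQuot hp t

theorem isShearLift_of_forall_cot_eq {κ c τ : ℝ} (hp : Φ (p + π) = Φ p + π)
    (h : ∀ t, sin (t - p) ≠ 0 →
      cot (Φ t - Φ p) = κ * cot (t - p) + c + if 0 < sin (t - p) then τ else 0) :
    IsShearLift Φ p κ c τ := by
  refine ⟨hp, congrFun <| Continuous.ext_on (dense_compl_singularSet p p) ?_ ?_ fun t ht => ?_⟩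
  · have := H.continuous
    fun_prop
  · have := H.continuous_sinQuot hp
    fun_prop
  have htp := (notMem_singularSet.1 ht).1
  have hΦt := H.sin_sub_ne_zero hp htp
  have hcot := h t htp
  have hmax : τ * max (sin (t - p)) 0 = sin (t - p) * if 0 < sin (t - p) then τ else 0 := by
    split_ifs with hpos
    · rw [max_eq_left hpos.le, mul_comm]
    · rw [max_eq_right (not_lt.1 hpos), mul_zero, mul_zero]
  rw [Real.cot_eq_cos_div_sin, Real.cot_eq_cos_div_sin, div_eq_iff hΦt] at hcot
  rw [hcot, hmax, ← H.sinQuot_mul_sin hp]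
  field_simp

theorem exists_isShearLift_of_distinct (hp : Φ (p + π) = Φ p + π) (hq : Φ (q + π) = Φ q + π)
    (hpq : sin (p - q) ≠ 0) (hE : ∫ t in (0 : ℝ)..2 * π, eDensity u v t = 0) :
    ∃ κ c, IsShearLift Φ p κ c 0 := by
  set l := rexp (logSinQuot Φ q p - logSinQuot Φ p p)
  have hl : ∀ t, sinQuot Φ q t = l * sinQuot Φ p t := fun t => by
    rw [← H.exp_logSinQuot hp, ← H.exp_logSinQuot hq, ← Real.exp_add, Real.exp_eq_exp]
    linarith [H.logSinQuot_sub_eq_of_integral_eq_zero hp hq hpq hE t p]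
  have hΦpq := H.sin_sub_ne_zero hq hpq
  refine ⟨l * sin (p - q) / sin (Φ p - Φ q), l * cos (p - q) / sin (Φ p - Φ q) - cot (Φ p - Φ q),
    H.isShearLift_of_forall_cot_eq hp fun t ht => ?_⟩
  have hΦt := H.sin_sub_ne_zero hp ht
  have hsin : sin (Φ t - Φ q) * sin (t - p) = l * sin (Φ t - Φ p) * sin (t - q) := by
    rw [← H.sinQuot_mul_sin hp, ← H.sinQuot_mul_sin hq, hl]
    ring
  rw [← sub_add_sub_cancel (Φ t) (Φ p) (Φ q), ← sub_add_sub_cancel t p q, Real.sin_add,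
    Real.sin_add] at hsin
  rw [Real.cot_eq_cos_div_sin, Real.cot_eq_cos_div_sin, Real.cot_eq_cos_div_sin]
  simp only [ite_self]
  field_simp
  linear_combination hsin

theorem exists_isShearLift_of_double (hp : Φ (p + π) = Φ p + π) (hu : u (p + π) = u p)
    (hE : ∫ t in (0 : ℝ)..2 * π, eDensity u v t = 0) : ∃ κ c τ, IsShearLift Φ p κ c τ := by
  have hw := H.balanceDefect_eq_zero_of_double hp hu hE
  have hconst : ∀ t, sin (t - p) ≠ 0 → HasDerivAt (doubleCorrection Φ u p) 0 t := fun t ht => by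
    simpa [hw] using H.hasDerivAt_doubleCorrection hp (notMem_singularSet.2 ⟨ht, ht⟩)
  obtain ⟨a, b, hab⟩ := exists_eq_add_ite_of_hasDerivAt_zero hconst H.doubleCorrection_periodic
  refine ⟨rexp (-u p), rexp (-u p) * a, rexp (-u p) * b,
    H.isShearLift_of_forall_cot_eq hp fun t ht => ?_⟩
  have hcot := hab t ht
  rw [doubleCorrection, sub_eq_iff_eq_add] at hcot
  rw [← mul_div_cancel_right₀ (cot (Φ t - Φ p)) (exp_pos (u p)).ne', hcot, div_eq_mul_inv,
    ← Real.exp_neg]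
  split_ifs <;> ring

variable {κ c τ : ℝ} (hΦ : IsShearLift Φ p κ c τ)

include hΦ

theorem mul_exp_eq_one_of_isShearLift : κ * rexp (u p) = 1 := by
  have := hΦ.cos_eq p
  rw [← H.exp_logSinQuot hΦ.balance, H.logSinQuot_of_sin_eq_zero (by simp)] at this
  simp only [sub_self, Real.cos_zero, mul_one, Real.sin_zero, mul_zero, add_zero, max_self] at this
  linarith

theorem u_add_pi_eq_of_isShearLift : u (p + π) = u p := by
  have hpi := hΦ.cos_eq (p + π)
  rw [← H.exp_logSinQuot hΦ.balance, H.logSinQuot_of_sin_eq_zero (by simp), hΦ.balance] at hpi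
  have hκ := H.mul_exp_eq_one_of_isShearLift hΦ
  simp only [add_sub_cancel_left, Real.cos_pi, mul_neg, mul_one, Real.sin_pi, mul_zero, add_zero,
    max_self, neg_inj] at hpi
  refine Real.exp_injective (mul_left_cancel₀ (left_ne_zero_of_mul_eq_one hκ) ?_)
  linarith

theorem doubleCorrection_eq_of_isShearLift {t : ℝ} (ht : sin (t - p) ≠ 0) :
    doubleCorrection Φ u p t = rexp (u p) * (c + if 0 < sin (t - p) then τ else 0) := by
  have hQ := (H.sinQuot_pos hΦ.balance t).ne'
  have hκ := H.mul_exp_eq_one_of_isShearLift hΦ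
  rw [doubleCorrection, Real.cot_eq_cos_div_sin, Real.cot_eq_cos_div_sin, hΦ.cos_eq,
    ← H.sinQuot_mul_sin hΦ.balance]
  split_ifs with hpos
  · rw [max_eq_left hpos.le]
    field_simp
    linear_combination cos (t - p) * hκ
  · rw [max_eq_right (not_lt.1 hpos)]
    field_simp
    linear_combination cos (t - p) * hκ

theorem hasDerivAt_doubleCorrection_zero_of_isShearLift {t : ℝ} (ht : sin (t - p) ≠ 0) :
    HasDerivAt (doubleCorrection Φ u p) 0 t := by
  have hsin : ContinuousAt (fun t => sin (t - p)) t := by fun_prop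
  refine (hasDerivAt_const t (doubleCorrection Φ u p t)).congr_of_eventuallyEq ?_
  rcases ht.lt_or_gt with hneg | hpos
  · filter_upwards [hsin.eventually_lt_const hneg] with s hs
    rw [H.doubleCorrection_eq_of_isShearLift hΦ ht, H.doubleCorrection_eq_of_isShearLift hΦ hs.ne,
      if_neg hneg.not_gt, if_neg hs.not_gt]
  · filter_upwards [hsin.eventually_const_lt hpos] with s hs
    rw [H.doubleCorrection_eq_of_isShearLift hΦ ht, H.doubleCorrection_eq_of_isShearLift hΦ hs.ne',
      if_pos hpos, if_pos hs]

theorem balanceDefect_eq_zero_of_isShearLift : balanceDefect Φ u p p = 0 := by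
  refine (H.continuous_balanceDefect hΦ.balance hΦ.balance).ext_on (dense_compl_singularSet p p)
    continuous_zero fun t ht => ?_
  have hzero := (H.hasDerivAt_doubleCorrection hΦ.balance ht).unique
    (H.hasDerivAt_doubleCorrection_zero_of_isShearLift hΦ (notMem_singularSet.1 ht).1)
  rcases mul_eq_zero.1 hzero with h | h
  · nlinarith [sq_nonneg (cot (t - p))]
  · exact Real.exp_eq_one_iff _ |>.1 (sub_eq_zero.1 h).symm

theorem integral_eDensity_eq_zero_of_isShearLift :
    ∫ t in (0 : ℝ)..2 * π, eDensity u v t = 0 := by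
  have hp := hΦ.balance
  have hu := H.u_add_pi_eq_of_isShearLift hΦ
  have hw := H.balanceDefect_eq_zero_of_isShearLift hΦ
  refine le_antisymm ?_ (H.integral_eDensity_nonneg_of_double hp hu)
  have hcal := H.calibrates_calibration hp hp (fun _ => H.hasDerivAt_doubleCorrection hp)
    fun _ hx => H.exists_tendsto_calibration_double hp hu (or_self_iff.1 hx)
  have hneg : Calibrates (-calibration Φ u (doubleCorrection Φ u p) p p) 0
      (fun t => -eDensity u v t) (singularSet p p) := by
    refine ⟨fun a b hab => (hcal.absolutelyContinuous a b hab).neg, ?_, fun x =>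
      let ⟨l, hl⟩ := hcal.exists_tendsto x; ⟨-l, hl.neg⟩⟩
    filter_upwards [H.ae_hasDerivAt] with t hut ht
    have hw' := H.hasDerivAt_balanceDefect hp hp hut ht
    rw [hw] at hw'
    have hderiv := H.hasDerivAt_calibration hp hp (fun _ => H.hasDerivAt_doubleCorrection hp) hut ht
    rw [hderiv.neg.deriv, hw, hw'.unique (hasDerivAt_const t 0)]
    simp
  have hE := hneg.integral_nonneg two_pi_pos (fun a b => (H.intervalIntegrable_eDensity a b).neg)
    (H.eDensity_periodic.comp Neg.neg)
    ((H.calibration_periodic H.doubleCorrection_periodic).comp Neg.neg) add_two_pi_mem_singularSet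
    continuousOn_const (fun _ => le_rfl) (compl_singularSet_mem_nhdsNE p p)
  rw [intervalIntegral.integral_neg] at hE
  linarith

theorem shear_eq_zero_of_differentiableAt (hu : DifferentiableAt ℝ u p) : τ = 0 := by
  have hw := H.balanceDefect_eq_zero_of_isShearLift hΦ
  have hQ : ∀ t, sinQuot Φ p t = rexp ((u t + u p) / 2) := fun t => by
    rw [← H.exp_logSinQuot hΦ.balance, Real.exp_eq_exp]
    have := congrFun hw t
    rw [balanceDefect, H.logSinQuot_of_sin_eq_zero (t := p) (by simp), Pi.zero_apply] at this
    linarith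
  have habs : DifferentiableAt ℝ (fun t => τ * |sin (t - p)|) p := by
    have hΦd := (H.hasDerivAt p).differentiableAt
    have hd : DifferentiableAt ℝ (fun t => 2 * (cos (Φ t - Φ p) * rexp (-((u t + u p) / 2))
      - κ * cos (t - p) - c * sin (t - p)) - τ * sin (t - p)) p := by fun_prop
    refine hd.congr_of_eventuallyEq (Eventually.of_forall fun t => ?_)
    simp only [hΦ.cos_eq, hQ, Real.exp_neg]
    have hmax : 2 * max (sin (t - p)) 0 = sin (t - p) + |sin (t - p)| := by
      rw [add_abs_eq_two_nsmul_posPart, posPart_def, two_nsmul, two_mul]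
    field_simp
    linear_combination -τ * hmax
  by_contra hτ
  have harcsin : DifferentiableAt ℝ (fun x => p + arcsin x) 0 :=
    (differentiableAt_arcsin.2 ⟨by norm_num, by norm_num⟩).const_add p
  rw [← add_zero p, ← arcsin_zero] at habs
  refine not_differentiableAt_abs_zero (((habs.comp 0 harcsin).const_mul τ⁻¹)
    |>.congr_of_eventuallyEq ?_)
  filter_upwards [Icc_mem_nhds (show (-1 : ℝ) < 0 by norm_num) one_pos] with x hx
  simp [sin_arcsin hx.1 hx.2, hτ]

end CircleLift

/-! ### The derivative on the circle -/

theorem eq_I_mul_im_mul_of_hasDerivAt_coe {γ : ℝ → Circle} {z : ℂ} {t : ℝ}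
    (hγ : HasDerivAt (fun s => (γ s : ℂ)) z t) :
    z = Complex.I * (conj (γ t : ℂ) * z).im * γ t := by
  have hnorm := hγ.norm_sq.unique ((hasDerivAt_const t 1).congr_of_eventuallyEq
    (Eventually.of_forall fun s => by simp only [Circle.norm_coe, one_pow]))
  rw [Complex.inner, mul_eq_zero_iff_left two_ne_zero, mul_comm] at hnorm
  have hI : conj (γ t : ℂ) * z = Complex.I * (conj (γ t : ℂ) * z).im := by
    conv_lhs => rw [← Complex.re_add_im (conj (γ t : ℂ) * z), hnorm]
    simp [mul_comm]
  rw [← hI, mul_right_comm, Complex.conj_mul', Circle.norm_coe]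
  simp

theorem exists_hasDerivAt_exp_eq {γ : ℝ → Circle} (hγ : ContDiff ℝ 1 fun t => (γ t : ℂ)) :
    ∃ Φ : ℝ → ℝ, (∀ t, HasDerivAt Φ (conj (γ t : ℂ) * deriv (fun s => (γ s : ℂ)) t).im t) ∧
      ∀ t, γ t = Circle.exp (Φ t) := by
  set ρ : ℝ → ℝ := fun t => (conj (γ t : ℂ) * deriv (fun s => (γ s : ℂ)) t).im
  have hρ : Continuous ρ := Complex.continuous_im.comp <|
    (Complex.continuous_conj.comp hγ.continuous).mul hγ.continuous_deriv_one
  set Φ : ℝ → ℝ := fun t => Complex.arg (γ 0) + ∫ s in (0 : ℝ)..t, ρ s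
  have hΦ₀ : Circle.exp (Φ 0) = γ 0 := by
    simp only [Φ, intervalIntegral.integral_same, add_zero, Circle.exp_arg]
  have hΦ : ∀ t, HasDerivAt Φ (ρ t) t := fun t =>
    (intervalIntegral.integral_hasDerivAt_right (hρ.intervalIntegrable _ _)
      (hρ.stronglyMeasurableAtFilter _ _) hρ.continuousAt).const_add _
  have hquot : ∀ t, HasDerivAt (fun s => (γ s : ℂ) * Complex.exp (-(Φ s * Complex.I))) 0 t := by
    intro t
    have hγt := (hγ.differentiable one_ne_zero t).hasDerivAt
    rw [eq_I_mul_im_mul_of_hasDerivAt_coe hγt] at hγt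
    exact (hγt.mul ((hΦ t).ofReal_comp.mul_const Complex.I).neg.cexp).congr_deriv (by ring)
  refine ⟨Φ, hΦ, fun t => Circle.ext ?_⟩
  have hconst := is_const_of_deriv_eq_zero (fun s => (hquot s).differentiableAt)
    (fun s => (hquot s).deriv) t 0
  simp only [Complex.exp_neg, ← Circle.coe_exp, hΦ₀] at hconst
  rw [mul_inv_cancel₀ (Circle.coe_ne_zero _)] at hconst
  exact (mul_inv_eq_one₀ (Circle.coe_ne_zero _)).1 hconst

theorem contMDiff_coe_circle {n : ℕ∞ω} : ContMDiff (𝓡 1) 𝓘(ℝ, ℂ) n fun p : Circle => (p : ℂ) :=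
  have : Fact (Module.finrank ℝ ℂ = 1 + 1) := ⟨Complex.finrank_real_complex⟩
  contMDiff_coe_sphere

theorem contDiff_coe_comp_exp {n : ℕ∞ω} {φ : Circle → Circle} (h : ContMDiff (𝓡 1) (𝓡 1) n φ) :
    ContDiff ℝ n fun t => (φ (Circle.exp t) : ℂ) :=
  (contMDiff_coe_circle.comp (h.comp contMDiff_circleExp)).contDiff

theorem angDeriv_exp (φ : Circle → Circle) (t : ℝ) : angDeriv φ (Circle.exp t) =
    (conj (φ (Circle.exp t) : ℂ) * deriv (fun s => (φ (Circle.exp s) : ℂ)) t).im := by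
  simp only [angDeriv, ← Circle.exp_add]
  rw [deriv_comp_const_add (f := fun s => (φ (Circle.exp s) : ℂ)), add_zero]

theorem contDiff_angDeriv_comp_exp {n : ℕ∞ω} {φ : Circle → Circle}
    (h : ContMDiff (𝓡 1) (𝓡 1) (n + 1) φ) : ContDiff ℝ n fun t => angDeriv φ (Circle.exp t) := by
  have hφ := contDiff_coe_comp_exp h
  simp_rw [angDeriv_exp]
  exact Complex.imCLM.contDiff.comp <| (Complex.conjCLE.contDiff.comp (hφ.of_le le_self_add)).mul
    (contDiff_succ_iff_deriv.1 hφ).2.2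

theorem continuous_angDeriv {φ : Circle → Circle} (h : ContMDiff (𝓡 1) (𝓡 1) 1 φ) :
    Continuous (angDeriv φ) :=
  (Circle.isCoveringMap_exp.isQuotientMap Circle.exp_surjective).continuous_iff.2
    (contDiff_angDeriv_comp_exp (n := 0) (by simpa using h)).continuous

theorem exists_lift {φ : Circle → Circle} (h : ContMDiff (𝓡 1) (𝓡 1) 1 φ) :
    ∃ Φ : ℝ → ℝ, (∀ t, HasDerivAt Φ (angDeriv φ (Circle.exp t)) t) ∧
      ∀ t, φ (Circle.exp t) = Circle.exp (Φ t) := by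
  simpa only [angDeriv_exp] using exists_hasDerivAt_exp_eq (contDiff_coe_comp_exp h)

theorem integral_dtheta {f : Circle → ℝ} (hf : AEStronglyMeasurable f dtheta) :
    ∫ p, f p ∂dtheta = ∫ t in (0 : ℝ)..2 * π, f (Circle.exp t) := by
  rw [dtheta, integral_map Circle.exp.continuous.measurable.aemeasurable hf,
    intervalIntegral.integral_of_le two_pi_pos.le, integral_Ico_eq_integral_Ioc]

theorem intervalIntegrable_comp_exp {f : Circle → ℝ} (hf : Integrable f dtheta) (a b : ℝ) :
    IntervalIntegrable (fun t => f (Circle.exp t)) volume a b := by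
  refine (Circle.periodic_exp.comp f).intervalIntegrable₀ two_pi_pos.ne' ?_ a b
  rw [intervalIntegrable_iff_integrableOn_Ico_of_le two_pi_pos.le]
  exact (integrable_map_measure hf.1 Circle.exp.continuous.measurable.aemeasurable).1 hf

instance isFiniteMeasure_dtheta : IsFiniteMeasure dtheta := by
  unfold dtheta
  infer_instance

/-! ### Weak derivatives -/

theorem eq_fourierCoeff_zero_of_forall_ne_zero {T : ℝ} [Fact (0 < T)] {f : C(AddCircle T, ℂ)}
    (hf : ∀ n ≠ 0, fourierCoeff f n = 0) (x : AddCircle T) : f x = fourierCoeff f 0 := by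
  have hsum := has_pointwise_sum_fourier_series_of_summable
    (summable_of_ne_finset_zero (s := {0}) fun n hn => hf n (by simpa using hn)) x
  refine (hsum.unique (hasSum_single 0 fun n hn => by rw [hf n hn, zero_smul])).trans ?_
  simp

theorem fourierCoeff_two_pi_eq {g : ℝ → ℝ} (hg : Continuous g) {f : AddCircle (2 * π) → ℂ}
    [Fact (0 < 2 * π)] (hf : ∀ t : ℝ, f t = g t) (n : ℤ) :
    fourierCoeff f n = (1 / (2 * π) : ℝ) • ((∫ t in (0 : ℝ)..2 * π, g t * cos (n * t) : ℝ) -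
      (∫ t in (0 : ℝ)..2 * π, g t * sin (n * t) : ℝ) * Complex.I) := by
  have hintegrand : ∀ t : ℝ, fourier (-n) (t : AddCircle (2 * π)) • f t =
      (g t * cos (n * t) : ℝ) - (g t * sin (n * t) : ℝ) * Complex.I := fun t => by
    have hexp : 2 * (π : ℂ) * Complex.I * (-n : ℤ) * t / (2 * π : ℝ)
        = (-(n * t) : ℝ) * Complex.I := by
      push_cast
      field_simp
    rw [hf, fourier_coe_apply, hexp, Complex.exp_mul_I, ← Complex.ofReal_cos,
      ← Complex.ofReal_sin, Real.cos_neg, Real.sin_neg, smul_eq_mul]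
    push_cast
    ring
  simp_rw [fourierCoeff_eq_intervalIntegral _ _ 0, zero_add, hintegrand]
  rw [intervalIntegral.integral_sub, intervalIntegral.integral_mul_const,
    intervalIntegral.integral_ofReal, intervalIntegral.integral_ofReal]
  all_goals exact Continuous.intervalIntegrable (by fun_prop) _ _

theorem contMDiff_circle_zpow (n : ℤ) : ContMDiff (𝓡 1) (𝓡 1) ∞ fun p : Circle => p ^ n := by
  have : LieGroup (𝓡 1) ∞ Circle := LieGroup.of_le (n := ω) le_top
  cases n with
  | ofNat n => simpa using contMDiff_pow (I := 𝓡 1) (G := Circle) (n := ∞) n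
  | negSucc n => simpa using (contMDiff_pow (I := 𝓡 1) (G := Circle) (n := ∞) (n + 1)).inv

theorem coe_exp_zpow (n : ℤ) (t : ℝ) :
    ((Circle.exp t ^ n : Circle) : ℂ) = ⟨cos (n * t), sin (n * t)⟩ := by
  have harg : (n : ℂ) * (t * Complex.I) = (n * t : ℝ) * Complex.I := by push_cast; ring
  rw [Circle.coe_zpow, Circle.coe_exp, ← Complex.exp_int_mul, harg]
  exact Complex.ext (Complex.exp_ofReal_mul_I_re _) (Complex.exp_ofReal_mul_I_im _)

theorem eq_of_forall_integral_mul_deriv_eq_zero {g : ℝ → ℝ} (hg : Continuous g)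
    (hper : Function.Periodic g (2 * π))
    (h : ∀ ζ : Circle → ℝ, ContMDiff (𝓡 1) 𝓘(ℝ, ℝ) ∞ ζ →
      ∫ t in (0 : ℝ)..2 * π, g t * deriv (fun s => ζ (Circle.exp s)) t = 0) (s t : ℝ) :
    g s = g t := by
  have : Fact (0 < 2 * π) := ⟨two_pi_pos⟩
  have hzpow : ∀ n : ℤ, ContMDiff (𝓡 1) 𝓘(ℝ, ℂ) ∞ fun p : Circle => ((p ^ n : Circle) : ℂ) :=
    fun n => contMDiff_coe_circle.comp (contMDiff_circle_zpow n)
  have hcos : ∀ n : ℤ, n ≠ 0 → ∫ t in (0 : ℝ)..2 * π, g t * cos (n * t) = 0 := fun n hn => by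
    have := h (fun p => ((p ^ n : Circle) : ℂ).im) (Complex.imCLM.contDiff.contMDiff.comp (hzpow n))
    have hderiv : ∀ t, deriv (fun s => sin (n * s)) t = cos (n * t) * n := fun t => by
      simpa using ((hasDerivAt_id t).const_mul (n : ℝ)).sin.deriv
    simp_rw [coe_exp_zpow, hderiv] at this
    simpa [← mul_assoc, hn] using this
  have hsin : ∀ n : ℤ, n ≠ 0 → ∫ t in (0 : ℝ)..2 * π, g t * sin (n * t) = 0 := fun n hn => by
    have := h (fun p => ((p ^ n : Circle) : ℂ).re) (Complex.reCLM.contDiff.contMDiff.comp (hzpow n))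
    have hderiv : ∀ t, deriv (fun s => cos (n * s)) t = -(sin (n * t) * n) := fun t => by
      simpa using ((hasDerivAt_id t).const_mul (n : ℝ)).cos.deriv
    simp_rw [coe_exp_zpow, hderiv] at this
    simpa [← mul_assoc, hn] using this
  have hperC : Function.Periodic (fun t => (g t : ℂ)) (2 * π) := fun t => congrArg _ (hper t)
  let f : C(AddCircle (2 * π), ℂ) :=
    ⟨hperC.lift, continuous_coinduced_dom.2 (Complex.continuous_ofReal.comp hg)⟩
  have hf : ∀ t : ℝ, f t = g t := fun _ => rfl
  have hcoeff := eq_fourierCoeff_zero_of_forall_ne_zero (f := f) fun n hn => by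
    rw [fourierCoeff_two_pi_eq hg hf, hcos n hn, hsin n hn]
    simp
  exact Complex.ofReal_injective (by rw [← hf, ← hf, hcoeff, hcoeff])

theorem integral_primitive_mul_deriv {v z : ℝ → ℝ} {a b : ℝ}
    (hv : IntervalIntegrable v volume a b) (hv0 : ∫ t in a..b, v t = 0) (hz : ContDiff ℝ 1 z) :
    ∫ t in a..b, (∫ s in a..t, v s) * deriv z t = -∫ t in a..b, v t * z t := by
  have hzac : AbsolutelyContinuousOnInterval z a b := absolutelyContinuousOnInterval_of_hasDerivAt
    (fun t _ => (hz.differentiable one_ne_zero t).hasDerivAt) hz.continuous_deriv_one.continuousOn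
  have hvac := hv.absolutelyContinuousOnInterval_intervalIntegral left_mem_uIcc
  rw [hvac.integral_mul_deriv_eq_deriv_mul hzac, hv0, intervalIntegral.integral_same, zero_mul,
    zero_mul, sub_zero, zero_sub]
  congr 1
  refine intervalIntegral.integral_congr_ae ?_
  filter_upwards [hv.ae_hasDerivAt_integral] with t ht hmem
  rw [(ht (uIoc_subset_uIcc hmem) a left_mem_uIcc).deriv]

theorem partialTheta_exp (f : Circle → ℝ) (t : ℝ) :
    partialTheta f (Circle.exp t) = deriv (fun s => f (Circle.exp s)) t := by
  simp only [partialTheta, ← Circle.exp_add]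
  rw [deriv_comp_const_add (f := fun s => f (Circle.exp s)), add_zero]

theorem contDiff_comp_exp {n : ℕ∞ω} {ζ : Circle → ℝ} (h : ContMDiff (𝓡 1) 𝓘(ℝ, ℝ) n ζ) :
    ContDiff ℝ n fun t => ζ (Circle.exp t) :=
  (h.comp contMDiff_circleExp).contDiff

namespace IsWeakDeriv

variable {u v : Circle → ℝ} (h : IsWeakDeriv u v)

include h

theorem integral_comp_exp_mul_deriv (hu : AEStronglyMeasurable u dtheta)
    (hv : AEStronglyMeasurable v dtheta) {ζ : Circle → ℝ} (hζ : ContMDiff (𝓡 1) 𝓘(ℝ, ℝ) ∞ ζ) :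
    ∫ t in (0 : ℝ)..2 * π, u (Circle.exp t) * deriv (fun s => ζ (Circle.exp s)) t =
      -∫ t in (0 : ℝ)..2 * π, v (Circle.exp t) * ζ (Circle.exp t) := by
  have hcont : Continuous (partialTheta ζ) := by
    rw [(Circle.isCoveringMap_exp.isQuotientMap Circle.exp_surjective).continuous_iff]
    convert ((contDiff_comp_exp hζ).of_le (by simp)).continuous_deriv_one using 1
    exact funext (partialTheta_exp ζ)
  have hint := h ζ hζ
  rw [integral_dtheta (f := fun p => u p * _) (hu.mul hcont.aestronglyMeasurable),
    integral_dtheta (f := fun p => v p * _) (hv.mul hζ.continuous.aestronglyMeasurable)] at hint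
  simpa only [partialTheta_exp] using hint

theorem integral_eq_sub (hu : Continuous u) (hv : MemLp v 2 dtheta) (a b : ℝ) :
    ∫ t in a..b, v (Circle.exp t) = u (Circle.exp b) - u (Circle.exp a) := by
  have hvint := intervalIntegrable_comp_exp (hv.integrable one_le_two)
  set V : ℝ → ℝ := fun x => ∫ t in (0 : ℝ)..x, v (Circle.exp t)
  have hmean : V (2 * π) = 0 := by
    simpa using h.integral_comp_exp_mul_deriv hu.aestronglyMeasurable hv.1
      (contMDiff_const (c := (1 : ℝ)))
  have hVsub : ∀ x y, ∫ t in x..y, v (Circle.exp t) = V y - V x := fun x y =>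
    (intervalIntegral.integral_interval_sub_left (hvint _ _) (hvint _ _)).symm
  have hVper : Function.Periodic V (2 * π) := fun x => by
    have := (Circle.periodic_exp.comp v).intervalIntegral_add_eq x 0
    simp only [Function.comp_apply, hVsub, zero_add, hmean] at this
    linarith [show V 0 = 0 from intervalIntegral.integral_same]
  have hV : Continuous V := intervalIntegral.continuous_primitive hvint 0
  have huexp : Continuous fun t => u (Circle.exp t) := hu.comp Circle.exp.continuous
  have hconst := eq_of_forall_integral_mul_deriv_eq_zero (huexp.sub hV)
    ((Circle.periodic_exp.comp u).sub hVper) (fun ζ hζ => ?_) b a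
  · rw [hVsub]
    simp only [Pi.sub_apply] at hconst
    linarith
  have hz : ContDiff ℝ 1 fun t => ζ (Circle.exp t) := (contDiff_comp_exp hζ).of_le (by simp)
  have hz' := hz.continuous_deriv_one
  simp_rw [Pi.sub_apply, sub_mul]
  rw [intervalIntegral.integral_sub (f := fun t => u (Circle.exp t) * _) (g := fun t => V t * _)
    ((huexp.mul hz').intervalIntegrable _ _) ((hV.mul hz').intervalIntegrable _ _),
    integral_primitive_mul_deriv (hvint _ _) hmean hz,
    h.integral_comp_exp_mul_deriv hu.aestronglyMeasurable hv.1 hζ, sub_self]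

end IsWeakDeriv

/-! ### The energy of the lift -/

theorem weakDeriv_spec {u : Circle → ℝ} (hu : MemH1 u) :
    MemLp (weakDeriv u) 2 dtheta ∧ IsWeakDeriv u (weakDeriv u) := by
  rw [weakDeriv, dif_pos hu]
  exact hu.2.choose_spec

theorem exp_logAngDeriv (φ : DiffPlus 1) (p : Circle) :
    rexp (logAngDeriv φ.1 p) = angDeriv φ.1 p :=
  Real.exp_log (φ.2.2.2 p)

theorem continuous_logAngDeriv (φ : DiffPlus 1) : Continuous (logAngDeriv φ.1) :=
  (continuous_angDeriv φ.2.1).log fun p => (φ.2.2.2 p).ne'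

theorem exists_circleLift {φ : DiffPlus 1} (hφ : φ ∈ HDiff) : ∃ Φ : ℝ → ℝ,
    CircleLift Φ (logAngDeriv φ.1 ∘ Circle.exp) (weakDeriv (logAngDeriv φ.1) ∘ Circle.exp) ∧
      ∀ t, φ.1 (Circle.exp t) = Circle.exp (Φ t) := by
  obtain ⟨hH1, hlength⟩ := hφ
  obtain ⟨hv, hweak⟩ := weakDeriv_spec hH1
  have hu := continuous_logAngDeriv φ
  obtain ⟨Φ, hderiv, hΦ⟩ := exists_lift φ.2.1
  simp only [← exp_logAngDeriv] at hderiv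
  refine ⟨Φ, ⟨hderiv, fun t => ?_, intervalIntegrable_comp_exp (hv.integrable one_le_two),
    intervalIntegrable_comp_exp hv.integrable_sq, hweak.integral_eq_sub hu hv,
    Circle.periodic_exp.comp _⟩, hΦ⟩
  rw [integral_dtheta hu.rexp.aestronglyMeasurable] at hlength
  have hshift :=
    (Circle.periodic_exp.comp fun p => rexp (logAngDeriv φ.1 p)).intervalIntegral_add_eq t 0
  have hftc := intervalIntegral.integral_eq_sub_of_hasDerivAt (a := t) (b := t + 2 * π)
    (fun s _ => hderiv s) ((hu.rexp.comp Circle.exp.continuous).intervalIntegrable _ _)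
  simp only [Function.comp_apply, zero_add, hlength] at hshift hftc
  linarith

theorem EGstar_eq_integral_eDensity {φ : DiffPlus 1} (hφ : φ ∈ HDiff) :
    EGstar φ.1 = ∫ t in (0 : ℝ)..2 * π,
      eDensity (logAngDeriv φ.1 ∘ Circle.exp) (weakDeriv (logAngDeriv φ.1) ∘ Circle.exp) t := by
  have hv := (weakDeriv_spec hφ.1).1
  have hint : Integrable (fun p => 1 / 4 * weakDeriv (logAngDeriv φ.1) p ^ 2
      - rexp (2 * logAngDeriv φ.1 p)) dtheta :=
    (hv.integrable_sq.const_mul _).sub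
      (((continuous_logAngDeriv φ).const_mul 2).rexp.integrable_of_hasCompactSupport
        (HasCompactSupport.of_compactSpace _))
  simp only [EGstar, energy, eDensity, Function.comp_apply]
  rw [integral_dtheta hint.1, intervalIntegral.integral_add (intervalIntegrable_comp_exp hint _ _)
    (by simp)]
  simp

theorem exp_add_pi (t : ℝ) : Circle.exp (t + π) = -Circle.exp t :=
  Circle.ext (by simp)

theorem neg_mem_balancePoints {φ : Equiv.Perm Circle} {p : Circle} (hp : p ∈ balancePoints φ) :
    -p ∈ balancePoints φ := by
  simp only [balancePoints, mem_ofPred_eq] at hp ⊢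
  rw [hp, neg_neg, neg_neg]

theorem lift_add_lt_of_injective {φ : Circle → Circle} (hφ : φ.Injective) {Φ : ℝ → ℝ}
    (hcont : Continuous Φ) (hΦ : ∀ t, φ (Circle.exp t) = Circle.exp (Φ t)) {s t : ℝ}
    (hst : s ≤ t) (hts : t < s + 2 * π) : Φ t < Φ s + 2 * π := by
  by_contra! hle
  obtain ⟨r, hr, hrs⟩ := intermediate_value_Icc hst hcont.continuousOn
    ⟨by linarith [two_pi_pos], hle⟩
  have hexp : Circle.exp r = Circle.exp s := hφ (by rw [hΦ, hΦ, hrs, Circle.exp_add_two_pi])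
  rw [Circle.exp_injOn_Icc (by linarith) hr (left_mem_Icc.2 hst) hexp] at hrs
  linarith [two_pi_pos]

theorem exp_mem_balancePoints_iff {φ : Equiv.Perm Circle} {Φ : ℝ → ℝ} (hmono : StrictMono Φ)
    (hcont : Continuous Φ) (hΦ : ∀ t, φ (Circle.exp t) = Circle.exp (Φ t)) (t : ℝ) :
    Circle.exp t ∈ balancePoints φ ↔ Φ (t + π) = Φ t + π := by
  rw [balancePoints, mem_ofPred_eq, ← exp_add_pi, hΦ, hΦ, ← exp_add_pi]
  refine ⟨fun h => ?_, fun h => by rw [h]⟩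
  refine Circle.exp_injOn_Ico (a := Φ t) (b := Φ t + 2 * π) (by linarith) ⟨?_, ?_⟩ ⟨?_, ?_⟩ h
  · exact (hmono (by linarith [pi_pos])).le
  · exact lift_add_lt_of_injective φ.injective hcont hΦ (by linarith [pi_pos])
      (by linarith [pi_pos])
  all_goals linarith [pi_pos]

theorem exists_mem_balancePoints_of_four_le {φ : Equiv.Perm Circle} (hφ : 4 ≤ nB φ) :
    ∃ P ∈ balancePoints φ, ∃ Q ∈ balancePoints φ, Q ≠ P ∧ Q ≠ -P := by
  obtain ⟨P, hP⟩ : (balancePoints φ).Nonempty := by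
    rw [← encard_pos]
    exact lt_of_lt_of_le (by norm_num) hφ
  refine ⟨P, hP, ?_⟩
  by_contra! hpair
  have hsub : balancePoints φ ⊆ {P, -P} := fun Q hQ => or_iff_not_imp_left.2 (hpair Q hQ)
  have hcard := (hφ.trans (encard_le_encard hsub)).trans (encard_insert_le {-P} P)
  rw [encard_singleton] at hcard
  exact absurd hcard (by decide)

theorem exists_exp_mem_balancePoints {φ : Equiv.Perm Circle} (hφ : 4 ≤ nB φ) :
    ∃ p ∈ Icc 0 (2 * π), ∃ q ∈ Ioo p (p + π),
      Circle.exp p ∈ balancePoints φ ∧ Circle.exp q ∈ balancePoints φ := by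
  obtain ⟨P, hP, Q, hQ, hQP, hQP'⟩ := exists_mem_balancePoints_of_four_le hφ
  obtain ⟨p₀, rfl⟩ := Circle.exp_surjective P
  obtain ⟨q₀, rfl⟩ := Circle.exp_surjective Q
  obtain ⟨p, hp, hpp₀⟩ := Circle.periodic_exp.exists_mem_Ico two_pi_pos p₀ 0
  rw [zero_add] at hp
  have hper : Function.Periodic (fun t => ({Circle.exp t, -Circle.exp t} : Set Circle)) π :=
    fun t => by simp only [exp_add_pi, neg_neg, pair_comm]
  obtain ⟨q, hq, hqq₀⟩ := hper.exists_mem_Ico pi_pos q₀ p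
  have hmem : Circle.exp q ∈ ({Circle.exp q₀, -Circle.exp q₀} : Set Circle) := by
    simp only [hqq₀, mem_insert_iff, true_or]
  rw [hpp₀] at hP hQP hQP'
  refine ⟨p, ⟨hp.1, hp.2.le⟩, q, ⟨hq.1.lt_of_ne ?_, hq.2⟩, hP, ?_⟩
  · rintro rfl
    rcases hmem with h | h
    · exact hQP h.symm
    · exact hQP' (by rw [h, neg_neg])
  · rcases hmem with h | h <;> rw [h]
    exacts [hQ, neg_mem_balancePoints hQ]

/-! ### Limits of maps with four balance points -/

/-- The quadruples `p ≤ x ≤ q ≤ y ≤ p + π` of angles, with `p` in a fundamental domain, such that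
`p` and `q` are angles of balance points and `φ'` takes the same value at `x` and `x + π` and at
`y` and `y + π`. The weak inequalities make this a closed condition on `φ`. -/
def rolleQuadruples (φ : DiffPlus 1) : Set (ℝ × ℝ × ℝ × ℝ) :=
  {(p, x, q, y) | (p ∈ Icc 0 (2 * π) ∧ p ≤ x ∧ x ≤ q ∧ q ≤ y ∧ y ≤ p + π) ∧
    (φ.1 (-Circle.exp p) = -φ.1 (Circle.exp p) ∧ φ.1 (-Circle.exp q) = -φ.1 (Circle.exp q)) ∧
    angDeriv φ.1 (-Circle.exp x) = angDeriv φ.1 (Circle.exp x) ∧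
    angDeriv φ.1 (-Circle.exp y) = angDeriv φ.1 (Circle.exp y)}

theorem rolleQuadruples_nonempty {φ : DiffPlus 1} (hφ : φ ∈ BDiff 4) :
    (rolleQuadruples φ).Nonempty := by
  obtain ⟨p, hp, q, hq, hpb, hqb⟩ := exists_exp_mem_balancePoints hφ
  obtain ⟨Φ, hderiv, hΦ⟩ := exists_lift φ.2.1
  have hmono : StrictMono Φ := strictMono_of_hasDerivAt_pos hderiv fun t => φ.2.2.2 _
  have hcont : Continuous Φ := continuous_iff_continuousAt.2 fun t => (hderiv t).continuousAt
  have hiff := exp_mem_balancePoints_iff hmono hcont hΦ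
  have hderiv' : ∀ t, HasDerivAt (fun t => Φ (t + π) - Φ t)
      (angDeriv φ.1 (-Circle.exp t) - angDeriv φ.1 (Circle.exp t)) t := fun t => by
    rw [← exp_add_pi]
    exact ((hderiv (t + π)).comp_add_const t π).sub (hderiv t)
  have hrolle : ∀ a b, a < b → Circle.exp a ∈ balancePoints φ.1 →
      Circle.exp b ∈ balancePoints φ.1 → ∃ x ∈ Ioo a b,
        angDeriv φ.1 (-Circle.exp x) - angDeriv φ.1 (Circle.exp x) = 0 := fun a b hab ha hb =>
    exists_hasDerivAt_eq_zero hab (by fun_prop)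
      (by rw [(hiff a).1 ha, (hiff b).1 hb]; ring) fun t _ => hderiv' t
  obtain ⟨x, hx, hxe⟩ := hrolle p q hq.1 hpb hqb
  obtain ⟨y, hy, hye⟩ := hrolle q (p + π) hq.2 hqb
    (by rw [exp_add_pi]; exact neg_mem_balancePoints hpb)
  exact ⟨(p, x, q, y), ⟨hp, hx.1.le, hx.2.le, hy.1.le, hy.2.le⟩, ⟨hpb, hqb⟩, sub_eq_zero.1 hxe,
    sub_eq_zero.1 hye⟩

theorem tendstoUniformly_diffPlus (φ : DiffPlus 1) :
    TendstoUniformly (fun ψ : DiffPlus 1 => (ψ.1 : Circle → Circle)) φ.1 (𝓝 φ) ∧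
      TendstoUniformly (fun ψ : DiffPlus 1 => angDeriv ψ.1) (angDeriv φ.1) (𝓝 φ) := by
  have hinduced := continuous_induced_dom.tendsto φ
  rw [nhds_prod_eq] at hinduced
  exact ⟨UniformFun.tendsto_iff_tendstoUniformly.1 (tendsto_fst.comp hinduced),
    UniformFun.tendsto_iff_tendstoUniformly.1 (tendsto_snd.comp hinduced)⟩

theorem continuous_uncurry_of_tendstoUniformly {X Y Z : Type*} [TopologicalSpace X]
    [TopologicalSpace Y] [UniformSpace Z] {F : X → Y → Z} (hF : ∀ x, Continuous (F x))
    (hunif : ∀ x, TendstoUniformly F (F x) (𝓝 x)) : Continuous (Function.uncurry F) :=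
  continuous_iff_continuousAt.2 fun ⟨x, y⟩ =>
    TendstoUniformly.tendsto_comp (F := fun z : X × Y => F z.1)
      (fun u hu => (continuous_fst.tendsto (x, y)).eventually (hunif x u hu)) (hF x).continuousAt
      continuousAt_snd

theorem isClosed_setOf_mem_rolleQuadruples :
    IsClosed {x : DiffPlus 1 × ℝ × ℝ × ℝ × ℝ | x.2 ∈ rolleQuadruples x.1} := by
  have hφ := continuous_uncurry_of_tendstoUniformly (fun φ : DiffPlus 1 => φ.2.1.continuous)
    fun φ => (tendstoUniformly_diffPlus φ).1
  have hφ' := continuous_uncurry_of_tendstoUniformly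
    (fun φ : DiffPlus 1 => continuous_angDeriv φ.2.1) fun φ => (tendstoUniformly_diffPlus φ).2
  have hbalance : IsClosed {x : DiffPlus 1 × ℝ |
      x.1.1 (-Circle.exp x.2) = -x.1.1 (Circle.exp x.2)} :=
    isClosed_eq (hφ.comp (f := fun x : DiffPlus 1 × ℝ => (x.1, -Circle.exp x.2)) (by fun_prop))
      (hφ.comp (f := fun x : DiffPlus 1 × ℝ => (x.1, Circle.exp x.2)) (by fun_prop)).neg
  have hangle : IsClosed {x : DiffPlus 1 × ℝ |
      angDeriv x.1.1 (-Circle.exp x.2) = angDeriv x.1.1 (Circle.exp x.2)} :=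
    isClosed_eq (hφ'.comp (f := fun x : DiffPlus 1 × ℝ => (x.1, -Circle.exp x.2)) (by fun_prop))
      (hφ'.comp (f := fun x : DiffPlus 1 × ℝ => (x.1, Circle.exp x.2)) (by fun_prop))
  have horder : IsClosed {z : ℝ × ℝ × ℝ × ℝ | z.1 ∈ Icc 0 (2 * π) ∧ z.1 ≤ z.2.1 ∧
      z.2.1 ≤ z.2.2.1 ∧ z.2.2.1 ≤ z.2.2.2 ∧ z.2.2.2 ≤ z.1 + π} :=
    (isClosed_Icc.preimage continuous_fst).and <| (isClosed_le (by fun_prop) (by fun_prop)).and <|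
      (isClosed_le (by fun_prop) (by fun_prop)).and <|
        (isClosed_le (by fun_prop) (by fun_prop)).and (isClosed_le (by fun_prop) (by fun_prop))
  have hpair : ∀ f : ℝ × ℝ × ℝ × ℝ → ℝ, Continuous f →
      Continuous fun x : DiffPlus 1 × ℝ × ℝ × ℝ × ℝ => (x.1, f x.2) := by fun_prop
  exact (horder.preimage continuous_snd).inter <|
    ((hbalance.preimage (hpair (·.1) (by fun_prop))).inter
      (hbalance.preimage (hpair (·.2.2.1) (by fun_prop)))).inter <|
    (hangle.preimage (hpair (·.2.1) (by fun_prop))).inter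
      (hangle.preimage (hpair (·.2.2.2) (by fun_prop)))

theorem rolleQuadruples_subset_Icc (φ : DiffPlus 1) :
    rolleQuadruples φ ⊆ Icc 0 (3 * π, 3 * π, 3 * π, 3 * π) := by
  rintro ⟨p, x, q, y⟩ ⟨⟨⟨hp, hp'⟩, hpx, hxq, hqy, hyp⟩, -⟩
  have := pi_pos
  refine ⟨⟨?_, ?_, ?_, ?_⟩, ?_, ?_, ?_, ?_⟩ <;> dsimp only [Prod.fst_zero, Prod.snd_zero] <;>
    linarith

theorem isClosed_setOf_rolleQuadruples_nonempty :
    IsClosed {φ : DiffPlus 1 | (rolleQuadruples φ).Nonempty} := by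
  set K := Icc (0 : ℝ × ℝ × ℝ × ℝ) (3 * π, 3 * π, 3 * π, 3 * π)
  have hclosed : IsClosed {x : DiffPlus 1 × K | (x.2 : ℝ × ℝ × ℝ × ℝ) ∈ rolleQuadruples x.1} :=
    isClosed_setOf_mem_rolleQuadruples.preimage (continuous_id.prodMap continuous_subtype_val)
  convert isClosedMap_fst_of_compactSpace _ hclosed using 1
  ext φ
  exact ⟨fun ⟨z, hz⟩ => ⟨(φ, ⟨z, rolleQuadruples_subset_Icc φ hz⟩), hz, rfl⟩,
    fun ⟨⟨_, z⟩, hz, hzφ⟩ => hzφ ▸ ⟨z, hz⟩⟩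

theorem exists_exp_mem_balancePoints_of_mem_closure {φ : DiffPlus 1} (hφ : φ ∈ closure (BDiff 4)) :
    ∃ p, Circle.exp p ∈ balancePoints φ.1 ∧
      ((∃ q ∈ Ioo p (p + π), Circle.exp q ∈ balancePoints φ.1) ∨
        angDeriv φ.1 (-Circle.exp p) = angDeriv φ.1 (Circle.exp p)) := by
  obtain ⟨⟨p, x, q, y⟩, ⟨-, hpx, hxq, hqy, hyp⟩, ⟨hp, hq⟩, hx, hy⟩ :=
    closure_minimal (fun ψ hψ => rolleQuadruples_nonempty hψ)
      isClosed_setOf_rolleQuadruples_nonempty hφ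
  refine ⟨p, hp, ?_⟩
  rcases (hpx.trans hxq).eq_or_lt with rfl | hpq
  · rw [le_antisymm hxq hpx] at hx
    exact .inr hx
  rcases (hqy.trans hyp).eq_or_lt with rfl | hqp
  · rw [le_antisymm hyp hqy, exp_add_pi, neg_neg] at hy
    exact .inr hy.symm
  · exact .inl ⟨q, ⟨hpq, hqp⟩, hq⟩

/-! ### Möbius maps and shears -/

/-- The point `w` of the circle is the direction `z / |z|` of the nonzero vector `z`. -/
def IsDirection (w : Circle) (z : ℂ) : Prop := ∃ r : ℝ, 0 < r ∧ (r : ℂ) * w = z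

namespace IsDirection

variable {w w' : Circle} {z : ℂ}

theorem norm_mul (h : IsDirection w z) : (‖z‖ : ℂ) * w = z := by
  obtain ⟨r, hr, rfl⟩ := h
  rw [Complex.norm_mul, Complex.norm_of_nonneg hr.le, Circle.norm_coe, mul_one]

theorem ne_zero (h : IsDirection w z) : z ≠ 0 := by
  obtain ⟨r, hr, rfl⟩ := h
  exact mul_ne_zero (Complex.ofReal_ne_zero.2 hr.ne') (Circle.coe_ne_zero w)

theorem eq_of_isDirection (h : IsDirection w z) (h' : IsDirection w' z) : w = w' :=
  Circle.ext <| mul_left_cancel₀ (Complex.ofReal_ne_zero.2 (norm_ne_zero_iff.2 h.ne_zero))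
    (h.norm_mul.trans h'.norm_mul.symm)

theorem exp_arg (hz : z ≠ 0) : IsDirection (Circle.exp z.arg) z :=
  ⟨‖z‖, norm_pos_iff.2 hz, by rw [Circle.coe_exp, Complex.norm_mul_exp_arg_mul_I]⟩

theorem pos_mul (h : IsDirection w z) {r : ℝ} (hr : 0 < r) : IsDirection w (r * z) := by
  obtain ⟨s, hs, rfl⟩ := h
  exact ⟨r * s, mul_pos hr hs, by rw [Complex.ofReal_mul, mul_assoc]⟩

theorem circle_mul (h : IsDirection w z) (w' : Circle) : IsDirection (w' * w) (w' * z) := by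
  obtain ⟨r, hr, rfl⟩ := h
  exact ⟨r, hr, by rw [Circle.coe_mul, mul_left_comm]⟩

theorem of_linAct {L : Matrix.SpecialLinearGroup (Fin 2) ℝ} (h : IsDirection w z)
    (h' : IsDirection w' (linAct L w)) : IsDirection w' (linAct L z) := by
  obtain ⟨r, hr, rfl⟩ := h
  convert h'.pos_mul hr using 1
  apply Complex.ext <;> simp [linAct] <;> ring

end IsDirection

theorem isDirection_mk_iff {w : Circle} {a b : ℝ} :
    IsDirection w ⟨a, b⟩ ↔ ∃ r, 0 < r ∧ r * (w : ℂ).re = a ∧ r * (w : ℂ).im = b := by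
  simp [IsDirection, Complex.ext_iff]

theorem linAct_mul (L M : Matrix.SpecialLinearGroup (Fin 2) ℝ) (z : ℂ) :
    linAct (L * M) z = linAct L (linAct M z) := by
  simp only [linAct, Matrix.SpecialLinearGroup.coe_mul, Matrix.mul_apply, Fin.sum_univ_two]
  apply Complex.ext <;> ring

theorem linAct_one (z : ℂ) : linAct 1 z = z := by
  simp [linAct]

theorem linAct_ne_zero (L : Matrix.SpecialLinearGroup (Fin 2) ℝ) {z : ℂ} (hz : z ≠ 0) :
    linAct L z ≠ 0 := by
  intro hLz
  rw [← linAct_one z, ← inv_mul_cancel L, linAct_mul, hLz] at hz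
  exact hz (by simp [linAct, Complex.ext_iff])

/-- The rotation `z ↦ w * z` as a matrix. -/
noncomputable def rotationSL (w : Circle) : Matrix.SpecialLinearGroup (Fin 2) ℝ :=
  ⟨!![(w : ℂ).re, -(w : ℂ).im; (w : ℂ).im, (w : ℂ).re], by
    rw [Matrix.det_fin_two_of, neg_mul, sub_neg_eq_add, ← Complex.normSq_apply, Circle.normSq_coe]⟩

theorem linAct_rotationSL (w : Circle) (z : ℂ) : linAct (rotationSL w) z = w * z := by
  apply Complex.ext <;> simp [linAct, rotationSL, sub_eq_add_neg, add_comm]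

theorem mem_mob_iff {φ : Equiv.Perm Circle} : φ ∈ Mob ↔
    ∃ L : Matrix.SpecialLinearGroup (Fin 2) ℝ, ∀ p, IsDirection (φ p) (linAct L p) := by
  refine exists_congr fun L => forall_congr' fun p => ?_
  have hL := norm_pos_iff.2 (linAct_ne_zero L (Circle.coe_ne_zero p))
  rw [eq_div_iff (Complex.ofReal_ne_zero.2 hL.ne'), mul_comm]
  exact ⟨fun h => ⟨_, hL, h⟩, IsDirection.norm_mul⟩

theorem isDirection_exp_arg_linAct (L : Matrix.SpecialLinearGroup (Fin 2) ℝ) (p : Circle) :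
    IsDirection (Circle.exp (linAct L p).arg) (linAct L p) :=
  IsDirection.exp_arg (linAct_ne_zero L (Circle.coe_ne_zero p))

theorem exp_arg_linAct_of_mul_eq_one {L M : Matrix.SpecialLinearGroup (Fin 2) ℝ} (h : L * M = 1)
    (p : Circle) : Circle.exp (linAct L (Circle.exp (linAct M p).arg)).arg = p := by
  have hdir := (isDirection_exp_arg_linAct M p).of_linAct (isDirection_exp_arg_linAct L _)
  rw [← linAct_mul, h, linAct_one] at hdir
  exact hdir.eq_of_isDirection ⟨1, one_pos, by simp⟩

/-- The Möbius map of the circle defined by a matrix. -/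
noncomputable def mobPerm (L : Matrix.SpecialLinearGroup (Fin 2) ℝ) : Equiv.Perm Circle where
  toFun p := Circle.exp (linAct L p).arg
  invFun p := Circle.exp (linAct L⁻¹ p).arg
  left_inv := exp_arg_linAct_of_mul_eq_one (inv_mul_cancel L)
  right_inv := exp_arg_linAct_of_mul_eq_one (mul_inv_cancel L)

theorem mem_mob_of_forall_eq_mul {φ ψ : Equiv.Perm Circle} {r : Circle} (hψ : ψ ∈ Mob)
    (h : ∀ p, φ p = r * ψ p) : φ ∈ Mob := by
  obtain ⟨L, hL⟩ := mem_mob_iff.1 hψ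
  refine mem_mob_iff.2 ⟨rotationSL r * L, fun p => ?_⟩
  rw [linAct_mul, linAct_rotationSL, h]
  exact (hL p).circle_mul r

theorem coe_exp_eq (t : ℝ) : (Circle.exp t : ℂ) = ⟨cos t, sin t⟩ := by
  rw [Circle.coe_exp]
  exact Complex.ext (Complex.exp_ofReal_mul_I_re t) (Complex.exp_ofReal_mul_I_im t)

theorem coe_exp_add_pi_div_two (t : ℝ) : (Circle.exp (t + π / 2) : ℂ) = ⟨-sin t, cos t⟩ := by
  rw [coe_exp_eq, Real.cos_add_pi_div_two, Real.sin_add_pi_div_two]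

theorem exists_mem_mob_isDirection {κ : ℝ} (hκ : 0 < κ) (p c : ℝ) : ∃ M ∈ Mob, ∀ t,
    IsDirection (M (Circle.exp t)) ⟨-sin (t - p), κ * cos (t - p) + c * sin (t - p)⟩ := by
  have hsqrt : √κ ≠ 0 := (sqrt_pos.2 hκ).ne'
  set S : Matrix.SpecialLinearGroup (Fin 2) ℝ :=
    ⟨!![(√κ)⁻¹, 0; -c * (√κ)⁻¹, √κ], by
      rw [Matrix.det_fin_two_of, zero_mul, sub_zero, inv_mul_cancel₀ hsqrt]⟩
  set L := S * rotationSL (Circle.exp (π / 2 - p))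
  refine ⟨mobPerm L, mem_mob_iff.2 ⟨L, isDirection_exp_arg_linAct L⟩, fun t => ?_⟩
  have hL : linAct L (Circle.exp t) = linAct S ⟨-sin (t - p), cos (t - p)⟩ := by
    rw [linAct_mul, linAct_rotationSL, ← Circle.coe_mul, ← Circle.exp_add,
      ← coe_exp_add_pi_div_two]
    ring_nf
  have hdir : IsDirection (mobPerm L (Circle.exp t)) (linAct L (Circle.exp t)) :=
    isDirection_exp_arg_linAct L (Circle.exp t)
  convert hdir.pos_mul (sqrt_pos.2 hκ) using 1
  rw [hL]
  apply Complex.ext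
  · simp [linAct, S, hsqrt]
  · simp only [linAct, S, Complex.im_ofReal_mul, Matrix.of_apply, Matrix.cons_val_zero,
      Matrix.cons_val_one]
    field_simp
    rw [sq_sqrt hκ.le]
    ring

theorem exists_isDirection_of_mem_mob {M : Equiv.Perm Circle} (hM : M ∈ Mob) :
    ∃ p κ c, 0 < κ ∧ ∀ t,
      IsDirection (M (Circle.exp t)) ⟨-sin (t - p), κ * cos (t - p) + c * sin (t - p)⟩ := by
  obtain ⟨L, hL⟩ := mem_mob_iff.1 hM
  have hdet := L.det_coe
  rw [Matrix.det_fin_two] at hdet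
  set z : ℂ := ⟨-L 0 1, L 0 0⟩
  have hz : z ≠ 0 := fun h => by
    have hre : L 0 1 = 0 := neg_eq_zero.1 (congrArg Complex.re h)
    have him : L 0 0 = 0 := congrArg Complex.im h
    rw [hre, him] at hdet
    norm_num at hdet
  set ρ := ‖z‖
  set p := z.arg
  have hρ : 0 < ρ := norm_pos_iff.2 hz
  have hcos : ρ * cos p = -L 0 1 := Complex.norm_mul_cos_arg z
  have hsin : ρ * sin p = L 0 0 := Complex.norm_mul_sin_arg z
  refine ⟨p, (ρ ^ 2)⁻¹, (L 1 1 * cos p - L 1 0 * sin p) / ρ, by positivity, fun t => ?_⟩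
  convert (hL (Circle.exp t)).pos_mul (inv_pos.2 hρ) using 1
  rw [coe_exp_eq]
  apply Complex.ext
  · simp only [linAct, Complex.re_ofReal_mul]
    field_simp
    rw [Real.sin_sub]
    linear_combination cos t * hsin - sin t * hcos
  · have hρdet : ρ * (L 1 0 * cos p + L 1 1 * sin p) = 1 := by
      linear_combination hdet + L 1 0 * hcos + L 1 1 * hsin
    have hrot : L 1 0 * cos t + L 1 1 * sin t = (L 1 0 * cos p + L 1 1 * sin p) * cos (t - p)
        + (L 1 1 * cos p - L 1 0 * sin p) * sin (t - p) := by
      conv_lhs => rw [← sub_add_cancel t p, Real.cos_add, Real.sin_add]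
      ring
    simp only [linAct, Complex.im_ofReal_mul]
    rw [hrot]
    field_simp
    linear_combination -cos (t - p) * hρdet

theorem exp_theta (p : Circle) : Circle.exp (theta p) = p := by
  rw [theta, toIcoMod, Circle.periodic_exp.sub_zsmul_eq, Circle.exp_arg]

theorem re_eq_cos_theta (p : Circle) : (p : ℂ).re = cos (theta p) := by
  conv_lhs => rw [← exp_theta p, coe_exp_eq]

theorem im_eq_sin_theta (p : Circle) : (p : ℂ).im = sin (theta p) := by
  conv_lhs => rw [← exp_theta p, coe_exp_eq]

theorem theta_mem_Ioo_iff (p : Circle) :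
    theta p ∈ Ioo (π / 2) (3 * π / 2) ↔ (p : ℂ).re < 0 := by
  have hθ : theta p ∈ Ico 0 (0 + 2 * π) := toIcoMod_mem_Ico two_pi_pos 0 _
  rw [re_eq_cos_theta]
  refine ⟨fun h => cos_neg_of_pi_div_two_lt_of_lt h.1 (by linarith [h.2]), fun h => ?_⟩
  contrapose! h
  rcases le_or_gt (theta p) (π / 2) with hle | hlt
  · exact cos_nonneg_of_mem_Icc ⟨by linarith [hθ.1, pi_pos], hle⟩
  · have hge : 3 * π / 2 ≤ theta p := not_lt.1 fun hlt' => h ⟨hlt, hlt'⟩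
    rw [← Real.cos_sub_two_pi]
    exact cos_nonneg_of_mem_Icc ⟨by linarith, by linarith [hθ.2, pi_pos]⟩

theorem isDirection_psi_self (τ : ℝ) (p : Circle) :
    IsDirection (psi τ p) ⟨(p : ℂ).re, (p : ℂ).im - τ * min (p : ℂ).re 0⟩ := by
  rcases lt_or_ge (p : ℂ).re 0 with hp | hp
  · rw [psi, if_pos ((theta_mem_Ioo_iff p).2 hp), min_eq_left hp.le]
    rw [re_eq_cos_theta] at hp ⊢
    rw [im_eq_sin_theta]
    set θ := theta p
    set w := τ + cot (θ - π / 2) with hw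
    have hcot : w = τ - sin θ / cos θ := by
      rw [hw, Real.cot_eq_cos_div_sin, Real.cos_sub_pi_div_two, Real.sin_sub_pi_div_two, div_neg,
        ← sub_eq_add_neg]
    have hcos := Real.cos_arctan_pos w
    have hsin : sin (arctan w) = w * cos (arctan w) := by
      rw [← Real.tan_mul_cos hcos.ne', Real.tan_arctan]
    refine isDirection_mk_iff.2 ⟨-cos θ / cos (arctan w), div_pos (neg_pos.2 hp) hcos, ?_⟩
    rw [coe_exp_add_pi_div_two, arccot, Real.sin_pi_div_two_sub, Real.cos_pi_div_two_sub, hsin,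
      hcot]
    have := hp.ne
    constructor
    · field_simp
    · field_simp
      ring
  · rw [psi, if_neg (mt (theta_mem_Ioo_iff p).1 hp.not_gt), min_eq_right hp]
    exact isDirection_mk_iff.2 ⟨1, one_pos, one_mul _, by ring⟩

theorem IsDirection.psi {w : Circle} {a b : ℝ} (h : IsDirection w ⟨a, b⟩) (τ : ℝ) :
    IsDirection (psi τ w) ⟨a, b - τ * min a 0⟩ := by
  obtain ⟨r, hr, rfl, rfl⟩ := isDirection_mk_iff.1 h
  convert (isDirection_psi_self τ w).pos_mul hr using 1
  apply Complex.ext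
  · rw [Complex.re_ofReal_mul]
  · rw [Complex.im_ofReal_mul, ← mul_zero r, ← mul_min_of_nonneg _ _ hr.le, mul_zero]
    ring

theorem psi_zero (p : Circle) : psi 0 p = p := by
  refine (isDirection_psi_self 0 p).eq_of_isDirection ⟨1, one_pos, ?_⟩
  simp

theorem exp_eq_exp_mul_iff {x y : ℝ} {w : Circle} :
    Circle.exp x = Circle.exp (y - π / 2) * w ↔ Circle.exp (x - y + π / 2) = w := by
  rw [← inv_mul_eq_iff_eq_mul, ← Circle.exp_neg, ← Circle.exp_add,
    show -(y - π / 2) + x = x - y + π / 2 by ring]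

namespace CircleLift

variable {Φ u v : ℝ → ℝ} (H : CircleLift Φ u v) {p κ c τ : ℝ}

include H

theorem isShearLift_iff : IsShearLift Φ p κ c τ ↔ ∀ t, IsDirection (Circle.exp (Φ t - Φ p + π / 2))
    ⟨-sin (t - p), κ * cos (t - p) + c * sin (t - p) + τ * max (sin (t - p)) 0⟩ := by
  simp only [isDirection_mk_iff, coe_exp_add_pi_div_two, mul_neg, neg_inj]
  refine ⟨fun hΦ t => ?_, fun h => H.isShearLift_of_forall_cot_eq ?_ fun t ht => ?_⟩
  · have hpos := H.sinQuot_pos hΦ.balance t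
    refine ⟨(sinQuot Φ p t)⁻¹, inv_pos.2 hpos, ?_, ?_⟩
    · rw [← H.sinQuot_mul_sin hΦ.balance, inv_mul_cancel_left₀ hpos.ne']
    · rw [hΦ.cos_eq, inv_mul_cancel_left₀ hpos.ne']
  · obtain ⟨r, hr, hsin, -⟩ := h (p + π)
    rw [add_sub_cancel_left, Real.sin_pi, mul_eq_zero_iff_left hr.ne', ← neg_eq_zero,
      ← Real.sin_sub_pi] at hsin
    have hlt : Φ p < Φ (p + π) := H.strictMono (by linarith [pi_pos])
    have hlt' : Φ (p + π) < Φ p + 2 * π := by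
      rw [← H.add_two_pi]
      exact H.strictMono (by linarith [pi_pos])
    linarith [(Real.sin_eq_zero_iff_of_lt_of_lt (by linarith) (by linarith)).1 hsin]
  · obtain ⟨r, hr, hsin, hcos⟩ := h t
    rw [Real.cot_eq_cos_div_sin, Real.cot_eq_cos_div_sin,
      ← mul_div_mul_left (cos (Φ t - Φ p)) _ hr.ne', hsin, hcos]
    split_ifs with hpos
    · rw [max_eq_left hpos.le]
      field_simp
    · rw [max_eq_right (not_lt.1 hpos)]
      field_simp
      ring

theorem exists_eq_mul_psi_of_isShearLift {φ : Circle → Circle}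
    (hφ : ∀ t, φ (Circle.exp t) = Circle.exp (Φ t)) (hΦ : IsShearLift Φ p κ c τ) :
    ∃ M ∈ Mob, ∀ P, φ P = Circle.exp (Φ p - π / 2) * psi τ (M P) := by
  have hκ : 0 < κ := pos_of_mul_pos_left
    (H.mul_exp_eq_one_of_isShearLift hΦ ▸ one_pos) (exp_pos _).le
  obtain ⟨M, hM, hdir⟩ := exists_mem_mob_isDirection hκ p c
  refine ⟨M, hM, fun P => ?_⟩
  rw [← Circle.exp_arg P, hφ, exp_eq_exp_mul_iff]
  refine (H.isShearLift_iff.1 hΦ _).eq_of_isDirection ?_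
  convert (hdir _).psi τ using 2
  rw [← neg_zero, min_neg_neg, neg_zero]
  ring

theorem exists_isShearLift_of_eq_mul_psi {φ : Circle → Circle}
    (hφ : ∀ t, φ (Circle.exp t) = Circle.exp (Φ t)) {r : Circle} {M : Equiv.Perm Circle}
    (hM : M ∈ Mob) (h : ∀ P, φ P = r * psi τ (M P)) : ∃ p κ c, IsShearLift Φ p κ c τ := by
  obtain ⟨p, κ, c, hκ, hdir⟩ := exists_isDirection_of_mem_mob hM
  have hpsi : ∀ t, IsDirection (psi τ (M (Circle.exp t)))
      ⟨-sin (t - p), κ * cos (t - p) + c * sin (t - p) + τ * max (sin (t - p)) 0⟩ := fun t => by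
    convert (hdir t).psi τ using 2
    rw [← neg_zero, min_neg_neg, neg_zero]
    ring
  have hp : psi τ (M (Circle.exp p)) = Circle.exp (π / 2) :=
    (hpsi p).eq_of_isDirection <| by
      exact isDirection_mk_iff.2 ⟨κ, hκ, by simp⟩
  have hr : r = Circle.exp (Φ p - π / 2) := by
    rw [Circle.exp_sub, ← hφ, h, hp, mul_div_cancel_right]
  refine ⟨p, κ, c, H.isShearLift_iff.2 fun t => ?_⟩
  rw [exp_eq_exp_mul_iff.1 (by rw [← hφ, h, hr])]
  exact hpsi t

end CircleLift

theorem sin_sub_ne_zero_of_mem_Ioo {p q : ℝ} (hq : q ∈ Ioo p (p + π)) : sin (p - q) ≠ 0 :=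
  (sin_neg_of_neg_of_neg_pi_lt (sub_neg.2 hq.1) (by linarith [hq.2])).ne

variable {φ : DiffPlus 1}

theorem CircleLift.exists_balance_of_mem_closure {Φ v : ℝ → ℝ}
    (H : CircleLift Φ (logAngDeriv φ.1 ∘ Circle.exp) v)
    (hΦ : ∀ t, φ.1 (Circle.exp t) = Circle.exp (Φ t)) (hφ : φ ∈ closure (BDiff 4)) :
    ∃ p, Φ (p + π) = Φ p + π ∧ ((∃ q, Φ (q + π) = Φ q + π ∧ sin (p - q) ≠ 0) ∨
      (logAngDeriv φ.1 ∘ Circle.exp) (p + π) = (logAngDeriv φ.1 ∘ Circle.exp) p) := by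
  have hbal := fun t => (exp_mem_balancePoints_iff H.strictMono H.continuous hΦ t).1
  obtain ⟨p, hp, ⟨q, hq, hq'⟩ | hdouble⟩ := exists_exp_mem_balancePoints_of_mem_closure hφ
  · exact ⟨p, hbal p hp, .inl ⟨q, hbal q hq', sin_sub_ne_zero_of_mem_Ioo hq⟩⟩
  · refine ⟨p, hbal p hp, .inr ?_⟩
    rw [Function.comp_apply, Function.comp_apply, exp_add_pi, logAngDeriv, hdouble, logAngDeriv]

theorem EGstar_nonneg (hH : φ ∈ HDiff) (hφ : φ ∈ closure (BDiff 4)) : 0 ≤ EGstar φ.1 := by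
  rw [EGstar_eq_integral_eDensity hH]
  obtain ⟨Φ, H, hΦ⟩ := exists_circleLift hH
  obtain ⟨p, hp, ⟨q, hq, hpq⟩ | hu⟩ := H.exists_balance_of_mem_closure hΦ hφ
  · exact H.integral_eDensity_nonneg_of_distinct hp hq hpq
  · exact H.integral_eDensity_nonneg_of_double hp hu

theorem exists_eq_mul_psi_of_EGstar_eq_zero (hH : φ ∈ HDiff) (hφ : φ ∈ closure (BDiff 4))
    (hE : EGstar φ.1 = 0) : ∃ (r : Circle) (τ : ℝ) (M : Equiv.Perm Circle),
      M ∈ Mob ∧ ∀ P, φ.1 P = r * psi τ (M P) := by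
  rw [EGstar_eq_integral_eDensity hH] at hE
  obtain ⟨Φ, H, hΦ⟩ := exists_circleLift hH
  obtain ⟨p, hp, hbal⟩ := H.exists_balance_of_mem_closure hΦ hφ
  obtain ⟨κ, c, τ, hshear⟩ : ∃ κ c τ, IsShearLift Φ p κ c τ := by
    rcases hbal with ⟨q, hq, hpq⟩ | hu
    · obtain ⟨κ, c, hshear⟩ := H.exists_isShearLift_of_distinct hp hq hpq hE
      exact ⟨κ, c, 0, hshear⟩
    · exact H.exists_isShearLift_of_double hp hu hE
  exact ⟨_, τ, H.exists_eq_mul_psi_of_isShearLift hΦ hshear⟩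

theorem EGstar_eq_zero_of_eq_mul_psi (hH : φ ∈ HDiff) {r : Circle} {τ : ℝ}
    {M : Equiv.Perm Circle} (hM : M ∈ Mob) (h : ∀ P, φ.1 P = r * psi τ (M P)) :
    EGstar φ.1 = 0 := by
  obtain ⟨Φ, H, hΦ⟩ := exists_circleLift hH
  obtain ⟨p, κ, c, hshear⟩ := H.exists_isShearLift_of_eq_mul_psi hΦ hM h
  rw [EGstar_eq_integral_eDensity hH, H.integral_eDensity_eq_zero_of_isShearLift hshear]

theorem mem_mob_of_eq_mul_psi_zero {ψ M : Equiv.Perm Circle} {r : Circle} (hM : M ∈ Mob)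
    (h : ∀ P, ψ P = r * psi 0 (M P)) : ψ ∈ Mob :=
  mem_mob_of_forall_eq_mul hM fun P => by rw [h, psi_zero]

theorem mem_mob_of_mem_bDiff (hH : φ ∈ HDiff) (hφ : φ ∈ BDiff 4) (hE : EGstar φ.1 = 0) :
    φ.1 ∈ Mob := by
  rw [EGstar_eq_integral_eDensity hH] at hE
  obtain ⟨Φ, H, hΦ⟩ := exists_circleLift hH
  have hbal := fun t => (exp_mem_balancePoints_iff H.strictMono H.continuous hΦ t).1
  obtain ⟨p, -, q, hpq, hp, hq⟩ := exists_exp_mem_balancePoints hφ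
  obtain ⟨κ, c, hshear⟩ := H.exists_isShearLift_of_distinct (hbal p hp) (hbal q hq)
    (sin_sub_ne_zero_of_mem_Ioo hpq) hE
  obtain ⟨M, hM, h⟩ := H.exists_eq_mul_psi_of_isShearLift hΦ hshear
  exact mem_mob_of_eq_mul_psi_zero hM h

theorem differentiable_logAngDeriv_comp_exp {ψ : Equiv.Perm Circle} (hψ : ψ ∈ DiffPlus 2) :
    Differentiable ℝ (logAngDeriv ψ ∘ Circle.exp) := by
  have hψ' : ContMDiff (𝓡 1) (𝓡 1) (1 + 1) ψ := by
    convert! hψ.1 using 1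
  exact ((contDiff_angDeriv_comp_exp hψ').differentiable one_ne_zero).log fun t => (hψ.2.2 _).ne'

theorem mem_mob_of_mem_diffPlus_two (hH : φ ∈ HDiff) (hφ : φ.1 ∈ DiffPlus 2) {r : Circle} {τ : ℝ}
    {M : Equiv.Perm Circle} (hM : M ∈ Mob) (h : ∀ P, φ.1 P = r * psi τ (M P)) : φ.1 ∈ Mob := by
  obtain ⟨Φ, H, hΦ⟩ := exists_circleLift hH
  obtain ⟨p, κ, c, hshear⟩ := H.exists_isShearLift_of_eq_mul_psi hΦ hM h
  obtain rfl := H.shear_eq_zero_of_differentiableAt hshear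
    (differentiable_logAngDeriv_comp_exp hφ p)
  exact mem_mob_of_eq_mul_psi_zero hM h

end OvalsBL

theorem mainTheorem3 (φ : DiffPlus 1) (hH : φ ∈ HDiff) (hB : φ ∈ closure (BDiff 4)) :
    0 ≤ EGstar φ.1 ∧
    (EGstar φ.1 = 0 ↔
      ∃ (r : Circle) (τ : ℝ) (φ' : Equiv.Perm Circle), φ' ∈ Mob ∧
        ∀ p : Circle, φ.1 p = r * psi τ (φ' p)) ∧
    ((φ.1 ∈ DiffPlus 2 ∨ φ ∈ BDiff 4) → (EGstar φ.1 = 0 ↔ φ.1 ∈ Mob)) := by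
  refine ⟨EGstar_nonneg hH hB, ⟨exists_eq_mul_psi_of_EGstar_eq_zero hH hB, ?_⟩,
    fun hφ => ⟨fun hE => ?_, fun hM => ?_⟩⟩
  · rintro ⟨r, τ, M, hM, h⟩
    exact EGstar_eq_zero_of_eq_mul_psi hH hM h
  · rcases hφ with h2 | h4
    · obtain ⟨r, τ, M, hM, h⟩ := exists_eq_mul_psi_of_EGstar_eq_zero hH hB hE
      exact mem_mob_of_mem_diffPlus_two hH h2 hM h
    · exact mem_mob_of_mem_bDiff hH h4 hE
  · exact EGstar_eq_zero_of_eq_mul_psi (r := 1) (τ := 0) hH hM fun P => by rw [psi_zero, one_mul]
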